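/- Let $p>1$, $\lambda>0$ and $n>1$ be real numbers. For $x\in\mathbb R$ put $x^{(p-1)}=|x|^{p-1}\operatorname{sign}(x)$, and let $$\pi_p=\int_{-1}^1\frac{ds}{(1-|s|^p)^{1/p}},\qquad \alpha=\Big(\frac{\lambda}{p-1}\Big)^{1/p}.$$ For $a\ge 0$ and $T(t)=-\frac{n-1}{t}$ or $T\equiv 0$, consider on $[a,\infty)$ the initial value problem $$\frac{d}{dt}\big(\dot w^{(p-1)}\big)=T\,\dot w^{(p-1)}-\lambda\,w^{(p-1)}\ \text{ for } t>a,\qquad w(a)=-1,\quad \dot w(a)=0,$$ where the derivative at $a$ is one-sided, $w\in C^1(a,\infty)$ and $\dot w^{(p-1)}\in C^1(a,\infty)$. For each $a\ge0$, and for either choice of $T$, it has exactly one solution $w=w_a$, and there is a first point $b(a)>a$ with $\dot w(b(a))=0$. Put $\delta(a)=b(a)-a$ and $m(a)=w_a(b(a))$. If $T\equiv0$, then $\delta(a)=\pi_p/\alpha$ for every $a\ge0$. If $T(t)=-\frac{n-1}{t}$, then: 1. $\delta$ is continuous on $[0,\infty)$, $\delta(a)>\pi_p/\alpha$ for every $a\in[0,\infty)$,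 and $\lim_{a\to\infty}\delta(a)=\pi_p/\alpha$; 2. $m(a)<1$ for every $a\in[0,\infty)$, and $\lim_{a\to\infty}m(a)=1$; 3. consequently $\delta$, extended by $\delta(\infty)=\pi_p/\alpha$, is a continuous function $[0,\infty]\to(0,\infty)$. -/

import Mathlib

open scoped ENNReal

noncomputable section

namespace PModel

/-- The signed power `x^{(p-1)} = |x|^{p-1} sign x = |x|^{p-2} x`. -/
def signedPow (p x : ℝ) : ℝ := |x| ^ (p - 1) * Real.sign x

/-- `π_p = ∫_{-1}^{1} ds / (1 - |s|^p)^{1/p}`. -/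
def piP (p : ℝ) : ℝ := ∫ s in (-1 : ℝ)..1, 1 / (1 - |s| ^ p) ^ (1 / p)

/-- `α = (λ / (p-1))^{1/p}`. -/
def alpha (p lam : ℝ) : ℝ := (lam / (p - 1)) ^ (1 / p)

/-- The damping coefficient `T(t) = -(n-1)/t`. -/
def damping (n t : ℝ) : ℝ := -(n - 1) / t

/-- `w` solves, on `[a, ∞)`, the initial value problem
`Δ_p w = T w'^{(p-1)} - λ w^{(p-1)}`, `w(a) = -1`, `w'(a) = 0`, where
`Δ_p w = (p-1) |w'|^{p-2} w''` is understood as the derivative of the flux `w'^{(p-1)}`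
(the usual meaning, as `w` need not be twice differentiable where `w' = 0`).
The derivative at `a` is one-sided.  For `T` continuous on `(a, ∞)` the last field also makes the
flux continuously differentiable there. -/
structure IsSolution (p lam : ℝ) (T : ℝ → ℝ) (a : ℝ) (w : ℝ → ℝ) : Prop where
  init : w a = -1
  init_deriv : HasDerivWithinAt w 0 (Set.Ici a) a
  contDiffOn : ContDiffOn ℝ 1 w (Set.Ioi a)
  ode : ∀ t, a < t → HasDerivAt (fun s => signedPow p (deriv w s))
    (T t * signedPow p (deriv w t) - lam * signedPow p (w t)) t

open scoped Classical in
/-- The solution of the initial value problem starting at `a`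
(only its values on `[a, ∞)` are meaningful; the zero function if there is no solution). -/
def sol (p lam : ℝ) (T : ℝ → ℝ) (a : ℝ) : ℝ → ℝ :=
  if h : ∃ w, IsSolution p lam T a w then h.choose else 0

/-- The critical points of the solution after the initial point. -/
def critAfter (p lam : ℝ) (T : ℝ → ℝ) (a : ℝ) : Set ℝ :=
  {t | a < t ∧ deriv (sol p lam T a) t = 0}

/-- `b(a)`, the first point after `a` at which `w' = 0`. -/
def firstCrit (p lam : ℝ) (T : ℝ → ℝ) (a : ℝ) : ℝ := sInf (critAfter p lam T a)

/-- `δ(a) = b(a) - a`. -/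
def delta (p lam : ℝ) (T : ℝ → ℝ) (a : ℝ) : ℝ := firstCrit p lam T a - a

/-- `m(a) = w(b(a))`. -/
def firstMax (p lam : ℝ) (T : ℝ → ℝ) (a : ℝ) : ℝ := sol p lam T a (firstCrit p lam T a)

open scoped Classical in
/-- `δ` on `[0, ∞]`, with `δ(∞) = π_p / α`. -/
def deltaExt (p lam : ℝ) (T : ℝ → ℝ) (a : ℝ≥0∞) : ℝ :=
  if a = ⊤ then piP p / alpha p lam else delta p lam T a.toReal

/-- For every `a ≥ 0` the initial value problem has exactly one solution on `[a, ∞)`, and its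
derivative has a first zero after `a`; so `b`, `δ` and `m` are well defined on `[0, ∞)`. -/
def WellDefined (p lam : ℝ) (T : ℝ → ℝ) : Prop :=
  ∀ a, 0 ≤ a →
    IsSolution p lam T a (sol p lam T a) ∧
    (∀ v, IsSolution p lam T a v → Set.EqOn v (sol p lam T a) (Set.Ici a)) ∧
    IsLeast (critAfter p lam T a) (firstCrit p lam T a)

end PModel

end

noncomputable section

namespace PModel

open Real Set Filter Topology MeasureTheory

/-! ### Signed powers -/

/-! The proof is a Prüfer substitution. Let `S`, `C` be the generalized sine and cosine, with `S' =
C` and `|S|^p + |C|^p = 1`, and let `q = π_p/2`, so that `S(±q) = ±1` and `C(±q) = 0`. Writing `w =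
A S(ϑ)` and `w' = α A C(ϑ)` with `K = (n-1)/(p-1)`, the problem splits into a scalar equation for
the angle, `ϑ' = α + (K/t) G(ϑ)` with `G = S C^{(p-1)}`, and a linear one for the amplitude, `A'/A =
-K |C(ϑ)|^p / t`. The solution starts at `ϑ(a) = -q`, `A(a) = 1`, and `b(a)` is the time at which
`ϑ` reaches `q`; there `w = A(b(a))`.

The force `G` is C¹ for every `p > 1`, with `G' = 1 - p|S|^p`, so the angle equation is Lipschitz
away from `t = 0`. At the singular time one uses `G'(-q) = 1 - p < 0`: near the initial angle `G` is
nonincreasing, so two angles do not separate there, however large `K/t` is. This gives uniqueness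
from `a = 0` (`IsAngle.unique`), existence from `a = 0` as a limit of `a → 0`
(`exists_isStart_zero`), and continuity in `a` (`tendsto_isStart`). As `G(±q) = 0`, the levels `±q`
are crossed upwards only, so `b` inherits continuity.

For `δ > π_p/α` (`IsHit.two_quarter_lt`), let `F` be the primitive of `G` vanishing at `±q`; it is
negative between. Then `αt - ϑ + (K/α) F(ϑ)/t` is strictly increasing, and its total increase over
the passage is `α δ - 2q`. Conversely `|G| ≤ 1` gives `(α - K/a) δ(a) ≤ 2q`, hence the limit. The
claims on `m` follow from the amplitude formula, and `T = 0` is the case `K = 0`.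

To see that every solution has this form (`IsSolution.eqOn_wave`), one shows that `w'` tends to `0`
at `a` and that the energy `|w|^p + |w'/α|^p` never vanishes; a continuous angle then exists, and it
solves the angle equation. -/

/-- The signed power `|x|^r sign x`. -/
def spow (r x : ℝ) : ℝ := |x| ^ r * Real.sign x

theorem signedPow_eq_spow (p x : ℝ) : signedPow p x = spow (p - 1) x := rfl

@[simp] theorem spow_zero (r : ℝ) : spow r 0 = 0 := by simp [spow]

theorem spow_of_pos {r x : ℝ} (hx : 0 < x) : spow r x = x ^ r := by
  simp [spow, Real.sign_of_pos hx, abs_of_pos hx]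

theorem spow_neg (r x : ℝ) : spow r (-x) = -spow r x := by
  simp [spow, Real.sign_neg]

theorem spow_const_mul {r c : ℝ} (hc : 0 < c) (x : ℝ) : spow r (c * x) = c ^ r * spow r x := by
  have h : Real.sign (c * x) = Real.sign x := by
    rcases lt_trichotomy x 0 with h | rfl | h
    · rw [Real.sign_of_neg h, Real.sign_of_neg (mul_neg_of_pos_of_neg hc h)]
    · simp
    · rw [Real.sign_of_pos h, Real.sign_of_pos (mul_pos hc h)]
  rw [spow, spow, h, abs_mul, abs_of_pos hc, Real.mul_rpow hc.le (abs_nonneg x), mul_assoc]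

@[simp] theorem spow_one (x : ℝ) : spow 1 x = x := by
  rcases lt_trichotomy x 0 with h | rfl | h
  · simp [spow, Real.sign_of_neg h, abs_of_neg h]
  · simp
  · simp [spow, Real.sign_of_pos h, abs_of_pos h]

theorem spow_pos {r x : ℝ} (hx : 0 < x) : 0 < spow r x := by
  rw [spow_of_pos hx]; positivity

theorem spow_neg_of_neg {r x : ℝ} (hx : x < 0) : spow r x < 0 := by
  have := spow_pos (r := r) (neg_pos.2 hx)
  rw [spow_neg] at this; linarith

theorem spow_eq_zero {r x : ℝ} : spow r x = 0 ↔ x = 0 := by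
  constructor
  · intro h
    rcases lt_trichotomy x 0 with hx | hx | hx
    · exact absurd h (spow_neg_of_neg hx).ne
    · exact hx
    · exact absurd h (spow_pos hx).ne'
  · rintro rfl; simp

theorem abs_spow {r : ℝ} (hr : r ≠ 0) (x : ℝ) : |spow r x| = |x| ^ r := by
  rcases lt_trichotomy x 0 with h | rfl | h
  · simp only [spow, Real.sign_of_neg h, mul_neg, mul_one, abs_neg]
    exact abs_of_nonneg (by positivity)
  · simp [Real.zero_rpow hr]
  · simp only [spow, Real.sign_of_pos h, mul_one]
    exact abs_of_nonneg (by positivity)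

theorem sign_spow (r x : ℝ) : Real.sign (spow r x) = Real.sign x := by
  rcases lt_trichotomy x 0 with h | rfl | h
  · rw [Real.sign_of_neg h, Real.sign_of_neg (spow_neg_of_neg h)]
  · simp
  · rw [Real.sign_of_pos h, Real.sign_of_pos (spow_pos h)]

theorem spow_spow {s : ℝ} (r : ℝ) (hs : s ≠ 0) (x : ℝ) : spow r (spow s x) = spow (s * r) x := by
  rw [spow, sign_spow, abs_spow hs, ← Real.rpow_mul (abs_nonneg x), spow]

theorem mul_spow {r : ℝ} (x : ℝ) (hr : r + 1 ≠ 0) : x * spow r x = |x| ^ (r + 1) := by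
  rcases lt_trichotomy x 0 with h | rfl | h
  · rw [Real.rpow_add_one (by simpa using h.ne), spow, Real.sign_of_neg h, abs_of_neg h]; ring
  · simp [Real.zero_rpow hr]
  · rw [Real.rpow_add_one (by simpa using h.ne'), spow, Real.sign_of_pos h, abs_of_pos h]; ring

theorem continuous_spow {r : ℝ} (hr : 0 < r) : Continuous (spow r) := by
  have h : spow r = fun x => (max x 0) ^ r - (max (-x) 0) ^ r := by
    funext x
    rcases lt_trichotomy x 0 with h | rfl | h
    · have := h.le
      rw [spow, Real.sign_of_neg h, abs_of_neg h, max_eq_right this,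
        max_eq_left (by linarith), Real.zero_rpow hr.ne']
      ring
    · simp
    · rw [spow, Real.sign_of_pos h, abs_of_pos h, max_eq_left h.le,
        max_eq_right (by linarith), Real.zero_rpow hr.ne']
      ring
  rw [h]
  refine Continuous.sub ?_ ?_
  · exact (continuous_id.max continuous_const).rpow_const fun _ => Or.inr hr.le
  · exact (continuous_neg.max continuous_const).rpow_const fun _ => Or.inr hr.le

theorem hasDerivAt_spow {r x : ℝ} (hx : x ≠ 0) : HasDerivAt (spow r) (r * |x| ^ (r - 1)) x := by
  rcases hx.lt_or_gt with h | h
  · have h1 : HasDerivAt (fun y : ℝ => -(-y) ^ r) (r * |x| ^ (r - 1)) x := by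
      have h0 : HasDerivAt (fun y : ℝ => -y) (-1) x := hasDerivAt_neg x
      rw [abs_of_neg h]
      refine (h0.rpow_const (p := r) (Or.inl (by simpa using hx))).fun_neg.congr_deriv ?_
      ring
    refine h1.congr_of_eventuallyEq ?_
    filter_upwards [Iio_mem_nhds h] with y hy
    have hy : y < 0 := hy
    rw [spow, Real.sign_of_neg hy, abs_of_neg hy]; ring
  · have h1 : HasDerivAt (fun y : ℝ => y ^ r) (r * |x| ^ (r - 1)) x := by
      rw [abs_of_pos h]
      exact Real.hasDerivAt_rpow_const (Or.inl hx)
    refine h1.congr_of_eventuallyEq ?_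
    filter_upwards [Ioi_mem_nhds h] with y hy
    exact spow_of_pos hy

theorem hasDerivAt_abs_rpow_spow {r : ℝ} (hr : 1 < r) (x : ℝ) :
    HasDerivAt (fun y => |y| ^ r) (r * spow (r - 1) x) x := by
  convert hasDerivAt_abs_rpow x hr using 1
  rcases lt_trichotomy x 0 with h | rfl | h
  · rw [spow, Real.sign_of_neg h, abs_of_neg h, show r - 1 = (r - 2) + 1 by ring,
      Real.rpow_add_one (by simpa using h.ne)]; ring
  · simp
  · rw [spow, Real.sign_of_pos h, abs_of_pos h, show r - 1 = (r - 2) + 1 by ring,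
      Real.rpow_add_one h.ne']; ring

/-! ### Calculus lemmas -/

/-- The fundamental theorem of calculus tolerates a countable exceptional set, so `f` is a primitive
of the continuous `g`. It repairs the chain rule where `sin β` or `cos β` vanishes. -/
theorem hasDerivAt_of_hasDerivAt_off_countable {f g : ℝ → ℝ} {s : Set ℝ} (hs : s.Countable)
    (hf : Continuous f) (hg : Continuous g) (h : ∀ x, x ∉ s → HasDerivAt f (g x) x) (x : ℝ) :
    HasDerivAt f (g x) x := by
  have h1 : ∀ y, ∫ u in (0 : ℝ)..y, g u = f y - f 0 := fun y =>
    integral_eq_of_hasDerivAt_off_countable f g hs hf.continuousOn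
      (fun u hu => h u hu.2) (hg.intervalIntegrable _ _)
  have h2 : f = fun y => f 0 + ∫ u in (0 : ℝ)..y, g u := by
    funext y; rw [h1]; ring
  rw [h2]
  exact (intervalIntegral.integral_hasDerivAt_right (hg.intervalIntegrable _ _)
    (hg.stronglyMeasurableAtFilter _ _) hg.continuousAt).const_add _

/-- A continuous lift of a differentiable function along a function with nonzero derivative is
differentiable. -/
theorem hasDerivAt_of_comp {f g : ℝ → ℝ} {t d f' : ℝ} (hg : ContinuousAt g t)
    (hf : HasDerivAt f f' (g t)) (hf' : f' ≠ 0) (hfg : HasDerivAt (fun s => f (g s)) d t) :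
    HasDerivAt g (d / f') t := by
  have hc : ContinuousAt (dslope f (g t)) (g t) :=
    continuousAt_dslope_same.2 hf.differentiableAt
  have hv : dslope f (g t) (g t) = f' := by rw [dslope_same, hf.deriv]
  have hc' : Tendsto (fun s => dslope f (g t) (g s)) (𝓝 t) (𝓝 f') := by
    have := hc.tendsto.comp hg.tendsto
    rwa [hv] at this
  have hne : ∀ᶠ s in 𝓝[≠] t, dslope f (g t) (g s) ≠ 0 :=
    (hc'.eventually_ne hf').filter_mono nhdsWithin_le_nhds
  rw [hasDerivAt_iff_tendsto_slope] at hfg ⊢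
  refine (hfg.div (hc'.mono_left nhdsWithin_le_nhds) hf').congr' ?_
  filter_upwards [hne] with s hs
  -- Carathéodory factorization, valid also when `g s = g t`: the slope of `g` is that of `f ∘ g`
  -- divided by a factor tending to `f'`.
  have key : f (g s) - f (g t) = (g s - g t) * dslope f (g t) (g s) := by
    have := sub_smul_dslope f (g t) (g s)
    rw [smul_eq_mul] at this
    exact this.symm
  simp only [Pi.div_apply, slope_def_field]
  rw [key]
  field_simp

/-! ### Generalized trigonometric functions

The curve `|x|^p + |y|^p = 1` is parametrized by `x = spow (2/p) (sin β)`, `y = spow (2/p) (cos β)`;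
the parameter `θ` with `dx = y dθ` satisfies `dθ = (2/p) |tan β|^{2/p-1} dβ`. -/

theorem measurable_tan : Measurable Real.tan := by
  have : Real.tan = fun x => Real.sin x / Real.cos x := funext Real.tan_eq_sin_div_cos
  rw [this]
  exact Real.measurable_sin.div Real.measurable_cos

/-- On this interval `x ≤ tan x ≤ 1`, so the power is at most `1` if `r ≥ 0` and at most `x ^ r`
otherwise. -/
theorem intervalIntegrable_abs_tan_rpow_quarter {r : ℝ} (hr : -1 < r) :
    IntervalIntegrable (fun x => |tan x| ^ r) volume 0 (π / 4) := by
  have hpi := Real.pi_pos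
  have h1 : IntervalIntegrable (fun x : ℝ => x ^ r + 1) volume 0 (π / 4) :=
    (intervalIntegral.intervalIntegrable_rpow' hr).add intervalIntegrable_const
  refine h1.mono_fun ((measurable_tan.abs.pow_const r).aestronglyMeasurable) ?_
  rw [Filter.EventuallyLE, ae_restrict_iff' measurableSet_uIoc]
  refine Eventually.of_forall fun x hx => ?_
  rw [uIoc_of_le (by positivity)] at hx
  have hx0 : 0 < x := hx.1
  have htan : x ≤ tan x := Real.le_tan hx0.le (by linarith [hx.2])
  have htpos : 0 < tan x := hx0.trans_le htan
  have htan1 : tan x ≤ 1 := by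
    rw [← Real.tan_pi_div_four]
    rcases hx.2.eq_or_lt with h | h
    · rw [h]
    · exact (Real.tan_lt_tan_of_lt_of_lt_pi_div_two (by linarith) (by linarith) h).le
  rw [abs_of_pos htpos, Real.norm_of_nonneg (by positivity), Real.norm_of_nonneg (by positivity)]
  rcases le_total 0 r with h | h
  · have : tan x ^ r ≤ 1 := Real.rpow_le_one htpos.le htan1 h
    have : 0 ≤ x ^ r := by positivity
    linarith
  · have : tan x ^ r ≤ x ^ r := Real.rpow_le_rpow_of_nonpos hx0 htan h
    linarith

/-- The reflection `x ↦ π/2 - x` inverts the tangent, so the poles are the zeros with exponent `-r`;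
this is where `r < 1` enters. Evenness and periodicity do the rest. -/
theorem intervalIntegrable_abs_tan_rpow {r : ℝ} (hr : -1 < r) (hr' : r < 1) (a b : ℝ) :
    IntervalIntegrable (fun x => |tan x| ^ r) volume a b := by
  have h1 := intervalIntegrable_abs_tan_rpow_quarter hr
  have h2 : IntervalIntegrable (fun x => |tan x| ^ r) volume (π / 4) (π / 2) := by
    have := (intervalIntegrable_abs_tan_rpow_quarter (r := -r) (by linarith)).comp_sub_left (π / 2)
    have h3 : (fun x => |tan (π / 2 - x)| ^ (-r)) = fun x => |tan x| ^ r := by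
      funext x
      rw [Real.tan_pi_div_two_sub, abs_inv, Real.inv_rpow (abs_nonneg _),
        Real.rpow_neg (abs_nonneg _), inv_inv]
    rw [h3] at this
    convert this.symm using 1 <;> ring
  have h4 := h1.trans h2
  have h5 : IntervalIntegrable (fun x => |tan x| ^ r) volume (-(π / 2)) 0 := by
    have := (IntervalIntegrable.comp_sub_left h4 0).symm
    simpa [Real.tan_neg] using this
  have hper : Function.Periodic (fun x => |tan x| ^ r) π := fun x => by
    simp only [Real.tan_periodic x]
  refine hper.intervalIntegrable (t := -(π / 2)) Real.pi_ne_zero ?_ a b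
  have := h5.trans h4
  convert this using 1; ring

/-- The density `dθ / dβ`. -/
def angleDensity (p β : ℝ) : ℝ := 2 / p * |tan β| ^ (2 / p - 1)

theorem two_div_sub_one_mem {p : ℝ} (hp : 1 < p) : -1 < 2 / p - 1 ∧ 2 / p - 1 < 1 := by
  have h0 : 0 < p := by linarith
  constructor
  · have : 0 < 2 / p := by positivity
    linarith
  · have : 2 / p < 2 := by rw [div_lt_iff₀ h0]; linarith
    linarith

theorem intervalIntegrable_angleDensity {p : ℝ} (hp : 1 < p) (a b : ℝ) :
    IntervalIntegrable (angleDensity p) volume a b :=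
  (intervalIntegrable_abs_tan_rpow (two_div_sub_one_mem hp).1 (two_div_sub_one_mem hp).2
    a b).const_mul _

theorem countable_tan_eq_zero : {β : ℝ | tan β = 0}.Countable := by
  have : {β : ℝ | tan β = 0} = range fun k : ℤ => (k : ℝ) * π / 2 := by
    ext β; simp [Real.tan_eq_zero_iff]
  rw [this]; exact countable_range _

theorem angleDensity_pos {p β : ℝ} (hp : 1 < p) (h : tan β ≠ 0) : 0 < angleDensity p β := by
  have : 0 < |tan β| := abs_pos.2 h
  have : 0 < p := by linarith
  unfold angleDensity; positivity

theorem angleDensity_nonneg {p : ℝ} (hp : 1 < p) (β : ℝ) : 0 ≤ angleDensity p β := by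
  have : 0 < p := by linarith
  unfold angleDensity; positivity

/-- The angle `θ` as a function of `β`. -/
def angleOf (p β : ℝ) : ℝ := ∫ x in (0 : ℝ)..β, angleDensity p x

theorem angleDensity_integral_pos {p x y : ℝ} (hp : 1 < p) (hxy : x < y) :
    0 < ∫ t in x..y, angleDensity p t := by
  rw [intervalIntegral.integral_pos_iff_support_of_nonneg_ae
    (Eventually.of_forall (angleDensity_nonneg hp)) (intervalIntegrable_angleDensity hp x y)]
  refine ⟨hxy, ?_⟩
  have hsub : Ioc x y \ {β : ℝ | tan β = 0} ⊆ Function.support (angleDensity p) ∩ Ioc x y :=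
    fun t ht => ⟨(angleDensity_pos hp ht.2).ne', ht.1⟩
  refine lt_of_lt_of_le ?_ (measure_mono hsub)
  rw [measure_sdiff_null (countable_tan_eq_zero.measure_zero _)]
  simpa using hxy

theorem strictMono_angleOf {p : ℝ} (hp : 1 < p) : StrictMono (angleOf p) := by
  intro x y hxy
  have h := angleDensity_integral_pos hp hxy
  have := intervalIntegral.integral_add_adjacent_intervals
    (intervalIntegrable_angleDensity hp 0 x) (intervalIntegrable_angleDensity hp x y)
  unfold angleOf; linarith

theorem continuous_angleOf {p : ℝ} (hp : 1 < p) : Continuous (angleOf p) :=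
  intervalIntegral.continuous_primitive (intervalIntegrable_angleDensity hp) 0

/-- The density is periodic with positive integral over a period, so its primitive is unbounded in
both directions. -/
theorem surjective_angleOf {p : ℝ} (hp : 1 < p) : Function.Surjective (angleOf p) := by
  have hper : Function.Periodic (angleDensity p) π := fun x => by
    simp only [angleDensity, Real.tan_periodic x]
  have hpos := angleDensity_integral_pos hp Real.pi_pos
  exact (continuous_angleOf hp).surjective
    (hper.tendsto_atTop_intervalIntegral_of_pos hpos Real.pi_pos)
    (hper.tendsto_atBot_intervalIntegral_of_pos hpos Real.pi_pos)

theorem angleOf_neg {p : ℝ} (β : ℝ) : angleOf p (-β) = -angleOf p β := by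
  unfold angleOf
  have h : ∀ x, angleDensity p (-x) = angleDensity p x := fun x => by
    simp [angleDensity, Real.tan_neg]
  have h2 := intervalIntegral.integral_comp_neg (a := 0) (b := β) (angleDensity p)
  simp only [h, neg_zero] at h2
  rw [h2, intervalIntegral.integral_symm]

theorem angleOf_zero (p : ℝ) : angleOf p 0 = 0 := by simp [angleOf]

theorem hasDerivAt_angleOf {p β : ℝ} (hp : 1 < p) (h : tan β ≠ 0) :
    HasDerivAt (angleOf p) (angleDensity p β) β := by
  have hcos : cos β ≠ 0 := fun hc => h (Real.tan_eq_zero_of_cos_eq_zero hc)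
  refine intervalIntegral.integral_hasDerivAt_right (intervalIntegrable_angleDensity hp 0 β) ?_ ?_
  · have : Measurable (angleDensity p) := (measurable_tan.abs.pow_const _).const_mul _
    exact this.stronglyMeasurable.stronglyMeasurableAtFilter
  · exact ((Real.continuousAt_tan.2 hcos).abs.rpow_const (Or.inl (abs_pos.2 h).ne')).const_mul _

/-- The inverse function `β` of `θ`. -/
def betaIso (p : ℝ) (hp : 1 < p) : ℝ ≃o ℝ :=
  ((strictMono_angleOf hp).orderIsoOfSurjective _ (surjective_angleOf hp)).symm

open scoped Classical in
/-- `β` as a function of `θ`. -/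
def betaOf (p θ : ℝ) : ℝ := if hp : 1 < p then betaIso p hp θ else 0

theorem angleOf_betaOf {p : ℝ} (hp : 1 < p) (θ : ℝ) : angleOf p (betaOf p θ) = θ := by
  simp only [betaOf, hp, dite_true]
  exact ((strictMono_angleOf hp).orderIsoOfSurjective _ (surjective_angleOf hp)).apply_symm_apply θ

theorem betaOf_angleOf {p : ℝ} (hp : 1 < p) (β : ℝ) : betaOf p (angleOf p β) = β :=
  (strictMono_angleOf hp).injective (angleOf_betaOf hp _)

theorem strictMono_betaOf {p : ℝ} (hp : 1 < p) : StrictMono (betaOf p) := by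
  have : betaOf p = betaIso p hp := by funext θ; simp [betaOf, hp]
  rw [this]; exact (betaIso p hp).strictMono

theorem continuous_betaOf {p : ℝ} (hp : 1 < p) : Continuous (betaOf p) := by
  have : betaOf p = betaIso p hp := by funext θ; simp [betaOf, hp]
  rw [this]; exact (betaIso p hp).continuous

theorem betaOf_neg {p : ℝ} (hp : 1 < p) (θ : ℝ) : betaOf p (-θ) = -betaOf p θ := by
  rw [← angleOf_betaOf hp θ, ← angleOf_neg, betaOf_angleOf hp, betaOf_angleOf hp]

theorem hasDerivAt_betaOf {p θ : ℝ} (hp : 1 < p) (h : tan (betaOf p θ) ≠ 0) :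
    HasDerivAt (betaOf p) (angleDensity p (betaOf p θ))⁻¹ θ :=
  (hasDerivAt_angleOf hp h).of_local_left_inverse (continuous_betaOf hp).continuousAt
    (angleDensity_pos hp h).ne' (Eventually.of_forall (angleOf_betaOf hp))

theorem countable_tan_betaOf_eq_zero {p : ℝ} (hp : 1 < p) :
    {θ | tan (betaOf p θ) = 0}.Countable :=
  countable_tan_eq_zero.preimage (strictMono_betaOf hp).injective

/-- The generalized sine, `S' = C`, `|S|^p + |C|^p = 1`. -/
def pSin (p θ : ℝ) : ℝ := spow (2 / p) (sin (betaOf p θ))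

/-- The generalized cosine. -/
def pCos (p θ : ℝ) : ℝ := spow (2 / p) (cos (betaOf p θ))

/-- The flux `C^{(p-1)}` of the generalized cosine. -/
def pFlux (p θ : ℝ) : ℝ := spow (2 - 2 / p) (cos (betaOf p θ))

theorem spow_pCos {p : ℝ} (hp : 1 < p) (θ : ℝ) : spow (p - 1) (pCos p θ) = pFlux p θ := by
  have h0 : 0 < p := by linarith
  rw [pCos, spow_spow _ (by positivity), pFlux]
  congr 1; field_simp

theorem spow_pSin {p : ℝ} (hp : 1 < p) (θ : ℝ) :
    spow (p - 1) (pSin p θ) = spow (2 - 2 / p) (sin (betaOf p θ)) := by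
  have h0 : 0 < p := by linarith
  rw [pSin, spow_spow _ (by positivity)]
  congr 1; field_simp

theorem abs_pSin_rpow {p : ℝ} (hp : 1 < p) (θ : ℝ) : |pSin p θ| ^ p = sin (betaOf p θ) ^ 2 := by
  have h0 : 0 < p := by linarith
  rw [pSin, abs_spow (by positivity), ← Real.rpow_mul (abs_nonneg _),
    div_mul_cancel₀ _ h0.ne', Real.rpow_two, sq_abs]

theorem abs_pCos_rpow {p : ℝ} (hp : 1 < p) (θ : ℝ) : |pCos p θ| ^ p = cos (betaOf p θ) ^ 2 := by
  have h0 : 0 < p := by linarith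
  rw [pCos, abs_spow (by positivity), ← Real.rpow_mul (abs_nonneg _),
    div_mul_cancel₀ _ h0.ne', Real.rpow_two, sq_abs]

theorem pSin_add_pCos {p : ℝ} (hp : 1 < p) (θ : ℝ) : |pSin p θ| ^ p + |pCos p θ| ^ p = 1 := by
  rw [abs_pSin_rpow hp, abs_pCos_rpow hp, Real.sin_sq_add_cos_sq]

theorem two_sub_two_div_pos {p : ℝ} (hp : 1 < p) : 0 < 2 - 2 / p := by
  linarith [(two_div_sub_one_mem hp).2]

theorem continuous_pSin {p : ℝ} (hp : 1 < p) : Continuous (pSin p) :=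
  (continuous_spow (div_pos two_pos (by linarith))).comp
    (Real.continuous_sin.comp (continuous_betaOf hp))

theorem continuous_pCos {p : ℝ} (hp : 1 < p) : Continuous (pCos p) :=
  (continuous_spow (div_pos two_pos (by linarith))).comp
    (Real.continuous_cos.comp (continuous_betaOf hp))

theorem continuous_pFlux {p : ℝ} (hp : 1 < p) : Continuous (pFlux p) :=
  (continuous_spow (two_sub_two_div_pos hp)).comp
    (Real.continuous_cos.comp (continuous_betaOf hp))

theorem hasDerivAt_pSin {p : ℝ} (hp : 1 < p) (θ : ℝ) : HasDerivAt (pSin p) (pCos p θ) θ := by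
  refine hasDerivAt_of_hasDerivAt_off_countable (countable_tan_betaOf_eq_zero hp)
    (continuous_pSin hp) (continuous_pCos hp) (fun x hx => ?_) θ
  have hx : tan (betaOf p x) ≠ 0 := hx
  have hc : cos (betaOf p x) ≠ 0 := fun hc => hx (Real.tan_eq_zero_of_cos_eq_zero hc)
  have hs : sin (betaOf p x) ≠ 0 := fun hs => hx (by rw [Real.tan_eq_sin_div_cos, hs, zero_div])
  have h1 := (hasDerivAt_spow (r := 2 / p) hs).comp x
    ((Real.hasDerivAt_sin _).comp x (hasDerivAt_betaOf hp hx))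
  refine h1.congr_deriv ?_
  have h0 : 0 < p := by linarith
  have hs' := abs_pos.2 hs
  have hc' := abs_pos.2 hc
  rw [angleDensity, Real.tan_eq_sin_div_cos, abs_div, Real.div_rpow hs'.le hc'.le, pCos]
  generalize cos (betaOf p x) = c at *
  generalize sin (betaOf p x) = s at *
  have h3 : spow (2 / p) c = c * |c| ^ (2 / p - 1) := by
    rcases hc.lt_or_gt with h | h
    · rw [spow, Real.sign_of_neg h, abs_of_neg h, Real.rpow_sub_one (by linarith)]
      field_simp
    · rw [spow_of_pos h, abs_of_pos h, Real.rpow_sub_one h.ne']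
      field_simp
  rw [h3]
  field_simp

/-- The flux is differentiated instead of the cosine because the latter, its `1/(p-1)` power, is not
differentiable at its zeros when `p > 2`. -/
theorem hasDerivAt_pFlux {p : ℝ} (hp : 1 < p) (θ : ℝ) :
    HasDerivAt (pFlux p) (-(p - 1) * spow (p - 1) (pSin p θ)) θ := by
  refine hasDerivAt_of_hasDerivAt_off_countable (countable_tan_betaOf_eq_zero hp)
    (g := fun θ => -(p - 1) * spow (p - 1) (pSin p θ))
    (continuous_pFlux hp) (continuous_const.mul ((continuous_spow (by linarith)).comp
      (continuous_pSin hp))) (fun x hx => ?_) θ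
  have hx : tan (betaOf p x) ≠ 0 := hx
  have hc : cos (betaOf p x) ≠ 0 := fun hc => hx (Real.tan_eq_zero_of_cos_eq_zero hc)
  have hs : sin (betaOf p x) ≠ 0 := fun hs => hx (by rw [Real.tan_eq_sin_div_cos, hs, zero_div])
  have h1 := (hasDerivAt_spow (r := 2 - 2 / p) hc).comp x
    ((Real.hasDerivAt_cos _).comp x (hasDerivAt_betaOf hp hx))
  refine h1.congr_deriv ?_
  have h0 : 0 < p := by linarith
  have hs' := abs_pos.2 hs
  have hc' := abs_pos.2 hc
  rw [angleDensity, Real.tan_eq_sin_div_cos, abs_div, Real.div_rpow hs'.le hc'.le, spow_pSin hp]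
  generalize cos (betaOf p x) = c at *
  generalize sin (betaOf p x) = s at *
  have h3 : spow (2 - 2 / p) s = s * |s| ^ (-(2 / p - 1)) := by
    rcases hs.lt_or_gt with h | h
    · rw [spow, Real.sign_of_neg h, abs_of_neg h,
        show 2 - 2 / p = -(2 / p - 1) + 1 by ring, Real.rpow_add_one (by linarith)]
      ring
    · rw [spow_of_pos h, abs_of_pos h,
        show 2 - 2 / p = -(2 / p - 1) + 1 by ring, Real.rpow_add_one h.ne']
      ring
  rw [h3, Real.rpow_neg hs'.le, show 2 - 2 / p - 1 = -(2 / p - 1) by ring, Real.rpow_neg hc'.le]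
  field_simp

/-- Half of the half-period: `π_p / 2`. -/
def quarter (p : ℝ) : ℝ := angleOf p (π / 2)

theorem betaOf_quarter {p : ℝ} (hp : 1 < p) : betaOf p (quarter p) = π / 2 := betaOf_angleOf hp _

theorem betaOf_neg_quarter {p : ℝ} (hp : 1 < p) : betaOf p (-quarter p) = -(π / 2) := by
  rw [betaOf_neg hp, betaOf_quarter hp]

theorem betaOf_zero {p : ℝ} (hp : 1 < p) : betaOf p 0 = 0 := by
  simpa [angleOf_zero] using betaOf_angleOf hp 0

theorem quarter_pos {p : ℝ} (hp : 1 < p) : 0 < quarter p := by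
  rw [← angleOf_zero p]; exact strictMono_angleOf hp (by positivity)

theorem pSin_quarter {p : ℝ} (hp : 1 < p) : pSin p (quarter p) = 1 := by
  rw [pSin, betaOf_quarter hp, Real.sin_pi_div_two, spow_of_pos one_pos, Real.one_rpow]

theorem pSin_neg {p : ℝ} (hp : 1 < p) (θ : ℝ) : pSin p (-θ) = -pSin p θ := by
  rw [pSin, betaOf_neg hp, Real.sin_neg, spow_neg, pSin]

theorem pFlux_neg {p : ℝ} (hp : 1 < p) (θ : ℝ) : pFlux p (-θ) = pFlux p θ := by
  rw [pFlux, betaOf_neg hp, Real.cos_neg, pFlux]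

theorem pSin_neg_quarter {p : ℝ} (hp : 1 < p) : pSin p (-quarter p) = -1 := by
  rw [pSin_neg hp, pSin_quarter hp]

theorem pCos_quarter {p : ℝ} (hp : 1 < p) : pCos p (quarter p) = 0 := by
  rw [pCos, betaOf_quarter hp, Real.cos_pi_div_two, spow_zero]

theorem pCos_neg_quarter {p : ℝ} (hp : 1 < p) : pCos p (-quarter p) = 0 := by
  rw [pCos, betaOf_neg_quarter hp, Real.cos_neg, Real.cos_pi_div_two, spow_zero]

theorem pFlux_eq_zero_of_pCos {p θ : ℝ} (hp : 1 < p) (h : pCos p θ = 0) : pFlux p θ = 0 := by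
  rw [← spow_pCos hp, h, spow_zero]

theorem cos_betaOf_pos {p θ : ℝ} (hp : 1 < p) (h : θ ∈ Ioo (-quarter p) (quarter p)) :
    0 < cos (betaOf p θ) := by
  refine Real.cos_pos_of_mem_Ioo ⟨?_, ?_⟩
  · rw [← betaOf_neg_quarter hp]; exact strictMono_betaOf hp h.1
  · rw [← betaOf_quarter hp]; exact strictMono_betaOf hp h.2

theorem pCos_pos {p θ : ℝ} (hp : 1 < p) (h : θ ∈ Ioo (-quarter p) (quarter p)) :
    0 < pCos p θ := spow_pos (cos_betaOf_pos hp h)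

theorem pFlux_pos {p θ : ℝ} (hp : 1 < p) (h : θ ∈ Ioo (-quarter p) (quarter p)) :
    0 < pFlux p θ := spow_pos (cos_betaOf_pos hp h)

theorem pSin_pos {p θ : ℝ} (hp : 1 < p) (h : θ ∈ Ioc 0 (quarter p)) : 0 < pSin p θ := by
  refine spow_pos (Real.sin_pos_of_mem_Ioo ⟨?_, ?_⟩)
  · rw [← betaOf_zero hp]; exact strictMono_betaOf hp h.1
  · have := (strictMono_betaOf hp).monotone h.2
    rw [betaOf_quarter hp] at this
    linarith [Real.pi_pos]

theorem abs_pSin_le_one {p : ℝ} (hp : 1 < p) (θ : ℝ) : |pSin p θ| ≤ 1 := by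
  rw [pSin, abs_spow (by have : 0 < p := by linarith
                         positivity)]
  exact Real.rpow_le_one (abs_nonneg _) (Real.abs_sin_le_one _) (by
    have : 0 < p := by linarith
    positivity)

theorem abs_pCos_le_one {p : ℝ} (hp : 1 < p) (θ : ℝ) : |pCos p θ| ≤ 1 := by
  rw [pCos, abs_spow (by have : 0 < p := by linarith
                         positivity)]
  exact Real.rpow_le_one (abs_nonneg _) (Real.abs_cos_le_one _) (by
    have : 0 < p := by linarith
    positivity)

theorem abs_pFlux_le_one {p : ℝ} (hp : 1 < p) (θ : ℝ) : |pFlux p θ| ≤ 1 := by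
  rw [pFlux, abs_spow (two_sub_two_div_pos hp).ne']
  exact Real.rpow_le_one (abs_nonneg _) (Real.abs_cos_le_one _) (two_sub_two_div_pos hp).le

theorem pCos_mul_pFlux {p : ℝ} (hp : 1 < p) (θ : ℝ) : pCos p θ * pFlux p θ = |pCos p θ| ^ p := by
  rw [← spow_pCos hp, mul_spow _ (by linarith), sub_add_cancel]

theorem pSin_mul_spow {p : ℝ} (hp : 1 < p) (θ : ℝ) :
    pSin p θ * spow (p - 1) (pSin p θ) = |pSin p θ| ^ p := by
  rw [mul_spow _ (by linarith), sub_add_cancel]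

/-- `π_p` is the length of the interval between consecutive zeros of the generalized cosine. -/
theorem piP_eq {p : ℝ} (hp : 1 < p) : piP p = 2 * quarter p := by
  have hq := quarter_pos hp
  have h0 : 0 < p := by linarith
  have hinj : StrictMonoOn (pSin p) (Icc (-quarter p) (quarter p)) := by
    refine strictMonoOn_of_deriv_pos (convex_Icc _ _) (continuous_pSin hp).continuousOn ?_
    intro x hx
    rw [interior_Icc] at hx
    rw [(hasDerivAt_pSin hp x).deriv]
    exact pCos_pos hp hx
  have himg : pSin p '' Ioo (-quarter p) (quarter p) = Ioo (-1) 1 := by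
    have hc : ContinuousOn (pSin p) (Icc (-quarter p) (quarter p)) :=
      (continuous_pSin hp).continuousOn
    apply Subset.antisymm
    · rintro _ ⟨x, hx, rfl⟩
      rw [← pSin_neg_quarter hp, ← pSin_quarter hp]
      exact ⟨hinj ⟨le_rfl, by linarith⟩ ⟨hx.1.le, hx.2.le⟩ hx.1,
        hinj ⟨hx.1.le, hx.2.le⟩ ⟨by linarith, le_rfl⟩ hx.2⟩
    · have := intermediate_value_Ioo (by linarith : -quarter p ≤ quarter p) hc
      rwa [pSin_neg_quarter hp, pSin_quarter hp] at this
  -- Substituting `s = S(θ)` on `(-q, q)`, the Jacobian `C` equals `(1 - |S|^p)^{1/p}` and the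
  -- integrand becomes `1`.
  have hmain := integral_image_eq_integral_abs_deriv_smul (f := pSin p) (f' := pCos p)
    measurableSet_Ioo (fun x (_ : x ∈ Ioo (-quarter p) (quarter p)) =>
      (hasDerivAt_pSin hp x).hasDerivWithinAt) (hinj.injOn.mono Ioo_subset_Icc_self)
    (fun s => 1 / (1 - |s| ^ p) ^ (1 / p))
  rw [himg] at hmain
  rw [piP, intervalIntegral.integral_of_le (by norm_num), integral_Ioc_eq_integral_Ioo, hmain]
  have h1 : ∀ x ∈ Ioo (-quarter p) (quarter p),
      |pCos p x| • (1 / (1 - |pSin p x| ^ p) ^ (1 / p)) = 1 := by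
    intro x hx
    have hc := pCos_pos hp hx
    rw [show 1 - |pSin p x| ^ p = |pCos p x| ^ p by linarith [pSin_add_pCos hp x],
      ← Real.rpow_mul (abs_nonneg _), mul_one_div_cancel h0.ne', Real.rpow_one, smul_eq_mul,
      mul_one_div_cancel (abs_pos.2 hc.ne').ne']
  rw [setIntegral_congr_fun measurableSet_Ioo h1]
  simp only [integral_const, smul_eq_mul, mul_one, measureReal_restrict_apply_univ,
    Real.volume_real_Ioo_of_le (by linarith : -quarter p ≤ quarter p)]
  ring

/-! ### The force in the angle equation -/

/-- The nonlinearity `S C^{(p-1)}` of the angle equation. -/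
def angleForce (p θ : ℝ) : ℝ := pSin p θ * pFlux p θ

/-- The product rule only meets `C C^{(p-1)} = |C|^p` and `S S^{(p-1)} = |S|^p`. The derivative is
therefore bounded, and the angle equation is Lipschitz for every `p > 1`. -/
theorem hasDerivAt_angleForce {p : ℝ} (hp : 1 < p) (θ : ℝ) :
    HasDerivAt (angleForce p) (1 - p * |pSin p θ| ^ p) θ := by
  refine ((hasDerivAt_pSin hp θ).mul (hasDerivAt_pFlux hp θ)).congr_deriv ?_
  have h1 := pCos_mul_pFlux hp θ
  have h2 := pSin_mul_spow hp θ
  have h3 := pSin_add_pCos hp θ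
  linear_combination h1 - (p - 1) * h2 + h3

theorem continuous_angleForce {p : ℝ} (hp : 1 < p) : Continuous (angleForce p) :=
  (continuous_pSin hp).mul (continuous_pFlux hp)

theorem abs_angleForce_le_one {p : ℝ} (hp : 1 < p) (θ : ℝ) : |angleForce p θ| ≤ 1 := by
  rw [angleForce, abs_mul]
  exact mul_le_one₀ (abs_pSin_le_one hp θ) (abs_nonneg _) (abs_pFlux_le_one hp θ)

theorem abs_deriv_angleForce_le {p : ℝ} (hp : 1 < p) (θ : ℝ) : |1 - p * |pSin p θ| ^ p| ≤ p := by
  have h1 : 0 ≤ |pSin p θ| ^ p := by positivity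
  have h2 : |pSin p θ| ^ p ≤ 1 :=
    Real.rpow_le_one (abs_nonneg _) (abs_pSin_le_one hp θ) (by linarith)
  rw [abs_le]; constructor <;> nlinarith

theorem abs_angleForce_sub_le {p : ℝ} (hp : 1 < p) (x y : ℝ) :
    |angleForce p x - angleForce p y| ≤ p * |x - y| := by
  have := Convex.norm_image_sub_le_of_norm_hasDerivWithin_le (f := angleForce p) (s := univ)
    (fun θ _ => (hasDerivAt_angleForce hp θ).hasDerivWithinAt)
    (fun θ _ => abs_deriv_angleForce_le hp θ) convex_univ (mem_univ y) (mem_univ x)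
  simpa using this

theorem angleForce_neg {p : ℝ} (hp : 1 < p) (θ : ℝ) : angleForce p (-θ) = -angleForce p θ := by
  rw [angleForce, pSin_neg hp, pFlux_neg hp, angleForce]; ring

theorem angleForce_quarter {p : ℝ} (hp : 1 < p) : angleForce p (quarter p) = 0 := by
  rw [angleForce, pFlux_eq_zero_of_pCos hp (pCos_quarter hp), mul_zero]

theorem angleForce_neg_quarter {p : ℝ} (hp : 1 < p) : angleForce p (-quarter p) = 0 := by
  rw [angleForce_neg hp, angleForce_quarter hp, neg_zero]

theorem angleForce_pos {p θ : ℝ} (hp : 1 < p) (h : θ ∈ Ioo 0 (quarter p)) :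
    0 < angleForce p θ :=
  mul_pos (pSin_pos hp ⟨h.1, h.2.le⟩) (pFlux_pos hp ⟨by linarith [h.1, quarter_pos hp], h.2⟩)

theorem angleForce_nonpos {p θ : ℝ} (hp : 1 < p) (h : θ ∈ Icc (-quarter p) 0) :
    angleForce p θ ≤ 0 := by
  rcases h.1.eq_or_lt with h1 | h1
  · rw [← h1, angleForce_neg_quarter hp]
  rcases h.2.eq_or_lt with h2 | h2
  · rw [h2, angleForce, pSin, betaOf_zero hp]; simp
  have := angleForce_pos hp (θ := -θ) ⟨by linarith, by linarith⟩
  rw [angleForce_neg hp] at this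
  linarith

/-- The force is nonincreasing near the initial angle. -/
theorem exists_antitoneOn_angleForce {p : ℝ} (hp : 1 < p) :
    ∃ ρ > 0, AntitoneOn (angleForce p) (Icc (-quarter p - ρ) (-quarter p + ρ)) := by
  have hc : Continuous fun θ => 1 - p * |pSin p θ| ^ p :=
    continuous_const.sub (continuous_const.mul
      ((continuous_pSin hp).abs.rpow_const fun _ => Or.inr (by linarith)))
  -- At `-q` one has `|S| = 1`, so the slope of the force there is `1 - p`.
  have h0 : (fun θ => 1 - p * |pSin p θ| ^ p) (-quarter p) < 0 := by
    simp only [pSin_neg_quarter hp, abs_neg, abs_one, Real.one_rpow]; linarith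
  obtain ⟨ρ, hρ, hball⟩ := Metric.eventually_nhds_iff.1 (hc.continuousAt.eventually_lt_const h0)
  refine ⟨ρ / 2, by positivity, ?_⟩
  refine antitoneOn_of_deriv_nonpos (convex_Icc _ _) (continuous_angleForce hp).continuousOn
    (fun x _ => (hasDerivAt_angleForce hp x).differentiableAt.differentiableWithinAt) ?_
  intro x hx
  rw [interior_Icc] at hx
  rw [(hasDerivAt_angleForce hp x).deriv]
  refine (hball ?_).le
  rw [Real.dist_eq, abs_lt]
  constructor <;> linarith [hx.1, hx.2]

/-! ### The angle equation -/

/-- The right-hand side `α + (K/t) S C^{(p-1)}` of the angle equation. -/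
def angleField (p α K t θ : ℝ) : ℝ := α + K / t * angleForce p θ

/-- `ϑ` solves the angle equation on `(c, ∞)`. -/
def IsAngle (p α K c : ℝ) (ϑ : ℝ → ℝ) : Prop :=
  ∀ t, c < t → HasDerivAt ϑ (angleField p α K t (ϑ t)) t

theorem IsAngle.mono {p α K c d : ℝ} {ϑ : ℝ → ℝ} (h : IsAngle p α K c ϑ) (hcd : c ≤ d) :
    IsAngle p α K d ϑ := fun t ht => h t (hcd.trans_lt ht)

theorem IsAngle.continuousOn {p α K c : ℝ} {ϑ : ℝ → ℝ} (h : IsAngle p α K c ϑ) :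
    ContinuousOn ϑ (Ioi c) := fun t ht => (h t ht).continuousAt.continuousWithinAt

theorem abs_angleField_sub_le {p α K t : ℝ} (hp : 1 < p) (hK : 0 ≤ K) (ht : 0 < t) (x y : ℝ) :
    |angleField p α K t x - angleField p α K t y| ≤ K * p / t * |x - y| := by
  have h := abs_angleForce_sub_le hp x y
  have h1 : angleField p α K t x - angleField p α K t y
      = K / t * (angleForce p x - angleForce p y) := by unfold angleField; ring
  have h2 : 0 ≤ K / t := by positivity
  rw [h1, abs_mul, abs_of_nonneg h2]
  calc K / t * |angleForce p x - angleForce p y| ≤ K / t * (p * |x - y|) := by gcongr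
    _ = K * p / t * |x - y| := by ring

theorem abs_angleField_le {p α K t : ℝ} (hp : 1 < p) (hα : 0 < α) (hK : 0 ≤ K) (ht : 0 < t)
    (x : ℝ) : |angleField p α K t x| ≤ α + K / t := by
  have h := abs_angleForce_le_one hp x
  have h2 : 0 ≤ K / t := by positivity
  unfold angleField
  calc |α + K / t * angleForce p x| ≤ |α| + |K / t * angleForce p x| := abs_add_le _ _
    _ ≤ α + K / t * 1 := by
      rw [abs_of_pos hα, abs_mul, abs_of_nonneg h2]; gcongr
    _ = α + K / t := by ring

theorem lipschitzOnWith_angleField {p α K s t : ℝ} (hp : 1 < p) (hK : 0 ≤ K) (hs : 0 < s)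
    (hst : s ≤ t) (u : Set ℝ) :
    LipschitzOnWith (Real.toNNReal (K * p / s)) (angleField p α K t) u := by
  refine LipschitzOnWith.of_dist_le_mul fun x _ y _ => ?_
  have h0 : 0 ≤ K * p := by nlinarith
  rw [Real.coe_toNNReal _ (by positivity), Real.dist_eq, Real.dist_eq]
  refine (abs_angleField_sub_le hp hK (hs.trans_le hst) x y).trans ?_
  gcongr

/-- Grönwall with the Lipschitz constant `K p / s`, which bounds `K p / r` for `r ≥ s`. It blows up
as `s → 0`, so the singular time needs `IsAngle.dist_le_of_antitone`. -/
theorem IsAngle.dist_le {p α K c s t : ℝ} {ϑ₁ ϑ₂ : ℝ → ℝ} (hp : 1 < p) (hK : 0 ≤ K) (hc : 0 ≤ c)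
    (h₁ : IsAngle p α K c ϑ₁) (h₂ : IsAngle p α K c ϑ₂) (hs : c < s) (hst : s ≤ t) :
    |ϑ₁ t - ϑ₂ t| ≤ |ϑ₁ s - ϑ₂ s| * exp (K * p / s * (t - s)) := by
  have hs0 : 0 < s := hc.trans_lt hs
  have h0 : 0 ≤ K * p := by nlinarith
  have := dist_le_of_trajectories_ODE_of_mem (v := angleField p α K) (s := fun _ => univ)
    (a := s) (b := t) (K := Real.toNNReal (K * p / s)) (f := ϑ₁) (g := ϑ₂)
    (δ := dist (ϑ₁ s) (ϑ₂ s))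
    (fun r hr => lipschitzOnWith_angleField hp hK hs0 hr.1 _)
    (h₁.continuousOn.mono fun r hr => hs.trans_le hr.1)
    (fun r hr => (h₁ r (hs.trans_le hr.1)).hasDerivWithinAt) (fun _ _ => mem_univ _)
    (h₂.continuousOn.mono fun r hr => hs.trans_le hr.1)
    (fun r hr => (h₂ r (hs.trans_le hr.1)).hasDerivWithinAt) (fun _ _ => mem_univ _) le_rfl
    t ⟨hst, le_rfl⟩
  rwa [Real.coe_toNNReal _ (by positivity), Real.dist_eq, Real.dist_eq] at this

/-- The field is bounded by `α + K/l` uniformly in the angle, so the Picard ball can be taken as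
large as the interval demands and no continuation is needed. -/
theorem exists_angle_Icc {p α K l u t₀ : ℝ} (hp : 1 < p) (hα : 0 < α) (hK : 0 ≤ K) (hl : 0 < l)
    (h1 : l ≤ t₀) (h2 : t₀ ≤ u) (y : ℝ) :
    ∃ ϑ : ℝ → ℝ, ϑ t₀ = y ∧
      ∀ t ∈ Icc l u, HasDerivWithinAt ϑ (angleField p α K t (ϑ t)) (Icc l u) t := by
  have hL : 0 ≤ α + K / l := by positivity
  have hM : 0 ≤ (α + K / l) * max (u - t₀) (t₀ - l) :=
    mul_nonneg hL (le_max_of_le_left (by linarith))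
  have hpl : IsPicardLindelof (angleField p α K) (tmin := l) (tmax := u) ⟨t₀, h1, h2⟩ y
      ⟨_, hM⟩ 0 ⟨_, hL⟩ (Real.toNNReal (K * p / l)) := by
    refine ⟨fun t ht => lipschitzOnWith_angleField hp hK hl ht.1 _, fun x _ => ?_,
      fun t ht x _ => ?_, ?_⟩
    · intro t ht
      have : t ≠ 0 := (hl.trans_le ht.1).ne'
      exact ((continuousAt_const.add ((continuousAt_const.div continuousAt_id this).mul
        continuousAt_const))).continuousWithinAt
    · refine (abs_angleField_le hp hα hK (hl.trans_le ht.1) x).trans ?_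
      change α + K / t ≤ α + K / l
      gcongr
      exact ht.1
    · simp only [NNReal.coe_zero, sub_zero]; exact le_rfl
  exact hpl.exists_eq_forall_mem_Icc_hasDerivWithinAt₀

theorem exists_isAngle {p α K t₀ : ℝ} (hp : 1 < p) (hα : 0 < α) (hK : 0 ≤ K) (ht₀ : 0 < t₀)
    (y : ℝ) : ∃ ϑ : ℝ → ℝ, ϑ t₀ = y ∧ IsAngle p α K 0 ϑ := by
  have hex : ∀ N : ℕ, ∃ ϑ : ℝ → ℝ, ϑ t₀ = y ∧ ∀ t ∈ Ioo (t₀ / (N + 2)) (t₀ * (N + 2)),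
      HasDerivAt ϑ (angleField p α K t (ϑ t)) t := by
    intro N
    have hN : (1 : ℝ) ≤ N + 2 := by linarith [(Nat.cast_nonneg N : (0 : ℝ) ≤ N)]
    obtain ⟨ϑ, h0, h⟩ := exists_angle_Icc hp hα hK (l := t₀ / (N + 2)) (u := t₀ * (N + 2))
      (by positivity) (div_le_self ht₀.le hN) (le_mul_of_one_le_right ht₀.le hN) y
    exact ⟨ϑ, h0, fun t ht => (h t ⟨ht.1.le, ht.2.le⟩).hasDerivAt (Icc_mem_nhds ht.1 ht.2)⟩
  choose φ hφ0 hφ using hex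
  have hmem : ∀ t, 0 < t → ∃ N : ℕ, t ∈ Ioo (t₀ / (N + 2)) (t₀ * (N + 2)) := by
    intro t ht
    obtain ⟨N, hN⟩ := exists_nat_gt (max (t₀ / t) (t / t₀))
    have h1 := (le_max_left _ _).trans_lt hN
    have h2 := (le_max_right _ _).trans_lt hN
    rw [div_lt_iff₀ ht] at h1
    rw [div_lt_iff₀ ht₀] at h2
    refine ⟨N, ?_, ?_⟩
    · rw [div_lt_iff₀ (by positivity)]; nlinarith
    · nlinarith
  have hagree : ∀ M N : ℕ, M ≤ N → EqOn (φ M) (φ N) (Ioo (t₀ / (M + 2)) (t₀ * (M + 2))) := by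
    intro M N hMN
    have hMN' : (M : ℝ) ≤ N := by exact_mod_cast hMN
    have hM : (1 : ℝ) < M + 2 := by linarith [(Nat.cast_nonneg M : (0 : ℝ) ≤ M)]
    have hsub : Ioo (t₀ / (M + 2)) (t₀ * (M + 2)) ⊆ Ioo (t₀ / (N + 2)) (t₀ * ((N : ℝ) + 2)) := by
      apply Ioo_subset_Ioo <;> gcongr
    refine ODE_solution_unique_of_mem_Ioo (v := angleField p α K) (s := fun _ => univ)
      (K := Real.toNNReal (K * p / (t₀ / (M + 2)))) (t₀ := t₀)
      (fun t ht => lipschitzOnWith_angleField hp hK (by positivity) ht.1.le _)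
      ⟨div_lt_self ht₀ hM, lt_mul_of_one_lt_right ht₀ hM⟩
      (fun t ht => ⟨hφ M t ht, mem_univ _⟩) (fun t ht => ⟨hφ N t (hsub ht), mem_univ _⟩)
      (by rw [hφ0, hφ0])
  choose! ν hν using hmem
  refine ⟨fun t => φ (ν t) t, hφ0 _, fun t ht => ?_⟩
  refine (hφ (ν t) t (hν t ht)).congr_of_eventuallyEq ?_
  filter_upwards [Ioo_mem_nhds (hν t ht).1 (hν t ht).2] with s hs
  have hs0 : 0 < s := lt_trans (by positivity) hs.1
  rcases le_total (ν s) (ν t) with h | h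
  · exact hagree _ _ h (hν s hs0)
  · exact (hagree _ _ h hs).symm

/-- The derivative of `ϑ₁ - ϑ₂` is `K/r` times a difference of forces of the opposite sign. The
bound contains no exponential, so `s` may tend to `0`. -/
theorem IsAngle.dist_le_of_antitone {p α K c s t : ℝ} {ϑ₁ ϑ₂ : ℝ → ℝ} {u : Set ℝ}
    (hK : 0 ≤ K) (hc : 0 ≤ c) (h₁ : IsAngle p α K c ϑ₁) (h₂ : IsAngle p α K c ϑ₂)
    (hu : AntitoneOn (angleForce p) u) (hs : c < s) (hst : s ≤ t)
    (hu₁ : ∀ r ∈ Icc s t, ϑ₁ r ∈ u) (hu₂ : ∀ r ∈ Icc s t, ϑ₂ r ∈ u) :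
    |ϑ₁ t - ϑ₂ t| ≤ |ϑ₁ s - ϑ₂ s| := by
  have hd : ∀ r, c < r → HasDerivAt (fun r => (ϑ₁ r - ϑ₂ r) ^ 2)
      (2 * (ϑ₁ r - ϑ₂ r) * (K / r * (angleForce p (ϑ₁ r) - angleForce p (ϑ₂ r)))) r := by
    intro r hr
    refine (((h₁ r hr).sub (h₂ r hr)).fun_pow 2).congr_deriv ?_
    simp only [angleField, Pi.sub_apply]; push_cast; ring
  have hanti : AntitoneOn (fun r => (ϑ₁ r - ϑ₂ r) ^ 2) (Icc s t) := by
    refine antitoneOn_of_deriv_nonpos (convex_Icc _ _)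
      (fun r hr => (hd r (hs.trans_le hr.1)).continuousAt.continuousWithinAt)
      (fun r hr => ?_) (fun r hr => ?_)
    · rw [interior_Icc] at hr
      exact (hd r (hs.trans hr.1)).differentiableAt.differentiableWithinAt
    · rw [interior_Icc] at hr
      rw [(hd r (hs.trans hr.1)).deriv]
      have hr' : r ∈ Icc s t := ⟨hr.1.le, hr.2.le⟩
      have hr0 : 0 < r := hc.trans_lt (hs.trans hr.1)
      have hKr : 0 ≤ K / r := by positivity
      have hprod : (ϑ₁ r - ϑ₂ r) * (angleForce p (ϑ₁ r) - angleForce p (ϑ₂ r)) ≤ 0 := by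
        rcases le_total (ϑ₁ r) (ϑ₂ r) with h | h
        · have := hu (hu₁ r hr') (hu₂ r hr') h
          exact mul_nonpos_of_nonpos_of_nonneg (by linarith) (by linarith)
        · have := hu (hu₂ r hr') (hu₁ r hr') h
          exact mul_nonpos_of_nonneg_of_nonpos (by linarith) (by linarith)
      nlinarith
  have := hanti ⟨le_rfl, hst⟩ ⟨hst, le_rfl⟩ hst
  exact sq_le_sq.1 this

/-- Solutions of the angle equation starting at `-π_p/2` at time `c ≥ 0` are unique. -/
theorem IsAngle.unique {p α K c : ℝ} {ϑ₁ ϑ₂ : ℝ → ℝ} (hp : 1 < p) (hK : 0 ≤ K) (hc : 0 ≤ c)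
    (h₁ : IsAngle p α K c ϑ₁) (h₂ : IsAngle p α K c ϑ₂)
    (hl₁ : Tendsto ϑ₁ (𝓝[>] c) (𝓝 (-quarter p))) (hl₂ : Tendsto ϑ₂ (𝓝[>] c) (𝓝 (-quarter p))) :
    EqOn ϑ₁ ϑ₂ (Ioi c) := by
  obtain ⟨ρ, hρ, hanti⟩ := exists_antitoneOn_angleForce hp
  have hnear : ∀ᶠ t in 𝓝[>] c, ϑ₁ t ∈ Icc (-quarter p - ρ) (-quarter p + ρ) ∧
      ϑ₂ t ∈ Icc (-quarter p - ρ) (-quarter p + ρ) :=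
    (hl₁.eventually (Icc_mem_nhds (by linarith) (by linarith))).and
      (hl₂.eventually (Icc_mem_nhds (by linarith) (by linarith)))
  obtain ⟨d, hd, hball⟩ := mem_nhdsGT_iff_exists_Ioo_subset.1 hnear
  have hd : c < d := hd
  -- The gap at `t` is at most the gap at every earlier `s`, which tends to `0` as `s → c`.
  have hsmall : ∀ t ∈ Ioo c d, ϑ₁ t = ϑ₂ t := by
    intro t ht
    have hlim : Tendsto (fun s => |ϑ₁ s - ϑ₂ s|) (𝓝[>] c) (𝓝 0) := by
      simpa using (hl₁.sub hl₂).abs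
    have hle : ∀ᶠ s in 𝓝[>] c, |ϑ₁ t - ϑ₂ t| ≤ |ϑ₁ s - ϑ₂ s| := by
      filter_upwards [Ioo_mem_nhdsGT ht.1] with s hs
      exact h₁.dist_le_of_antitone hK hc h₂ hanti hs.1 hs.2.le
        (fun r hr => (hball ⟨hs.1.trans_le hr.1, hr.2.trans_lt ht.2⟩).1)
        (fun r hr => (hball ⟨hs.1.trans_le hr.1, hr.2.trans_lt ht.2⟩).2)
    have := ge_of_tendsto hlim hle
    exact sub_eq_zero.1 (abs_eq_zero.1 (le_antisymm this (abs_nonneg _)))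
  intro t ht
  have ht : c < t := ht
  obtain ⟨s, hs1, hs2⟩ := exists_between (lt_min ht hd)
  have := h₁.dist_le hp hK hc h₂ hs1 (hs2.le.trans (min_le_left _ _))
  rw [hsmall s ⟨hs1, hs2.trans_le (min_le_right _ _)⟩, sub_self, abs_zero, zero_mul] at this
  exact sub_eq_zero.1 (abs_eq_zero.1 (le_antisymm this (abs_nonneg _)))

/-- Levels at which the force vanishes are crossed upwards only. -/
theorem IsAngle.lt_of_le {p α K c s t y : ℝ} {ϑ : ℝ → ℝ} (hα : 0 < α)
    (h : IsAngle p α K c ϑ) (hy : angleForce p y = 0) (hs : c < s) (hst : s < t) (hys : y ≤ ϑ s) :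
    y < ϑ t := by
  have hfield : ∀ r, ϑ r = y → angleField p α K r (ϑ r) = α := by
    intro r hr; rw [hr, angleField, hy]; ring
  have hle : ∀ r ∈ Icc s t, y ≤ ϑ r := by
    intro r hr
    refine image_le_of_deriv_right_lt_deriv_boundary' (f := fun _ => y) (f' := fun _ => 0)
      (B := ϑ) (B' := fun r => angleField p α K r (ϑ r)) continuousOn_const
      (fun x _ => hasDerivWithinAt_const _ _ _) hys
      (h.continuousOn.mono fun r hr => hs.trans_le hr.1)
      (fun x hx => (h x (hs.trans_le hx.1)).hasDerivWithinAt) (fun x hx hxy => ?_) hr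
    rw [hfield x hxy.symm]; exact hα
  -- Equality at `t` would give slope `α > 0` there, hence values below `y` just before `t`.
  refine (hle t ⟨hst.le, le_rfl⟩).lt_of_ne fun heq => ?_
  have hd := h t (hs.trans hst)
  rw [hfield t heq.symm] at hd
  have h1 : ∀ᶠ r in 𝓝[<] t, 0 < slope ϑ t r :=
    ((hasDerivAt_iff_tendsto_slope.1 hd).mono_left
      (nhdsWithin_mono _ fun r (hr : r < t) => hr.ne)).eventually_const_lt hα
  obtain ⟨r, hr1, hr2⟩ := (h1.and (Ioo_mem_nhdsLT hst)).exists
  rw [slope_def_field] at hr1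
  have := hle r ⟨hr2.1.le, hr2.2.le⟩
  have h3 : (ϑ r - ϑ t) / (r - t) ≤ 0 :=
    div_nonpos_of_nonneg_of_nonpos (by linarith) (by linarith [hr2.2])
  linarith

/-- The barrier stays in `[-q, 0]`, where the force is nonpositive and the slope of the angle is at
most `α < 2α`. The bound is free of `K/a`, hence uniform as `a → 0`. -/
theorem IsAngle.start_le {p α K a t : ℝ} {ϑ : ℝ → ℝ} (hp : 1 < p) (hα : 0 < α) (hK : 0 ≤ K)
    (ha : 0 < a) (h : IsAngle p α K 0 ϑ) (h0 : ϑ a = -quarter p) (hat : a ≤ t)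
    (ht : 2 * α * (t - a) ≤ quarter p) : ϑ t ≤ -quarter p + 2 * α * (t - a) := by
  refine image_le_of_deriv_right_lt_deriv_boundary (f := ϑ)
    (f' := fun r => angleField p α K r (ϑ r)) (B := fun r => -quarter p + 2 * α * (r - a))
    (B' := fun _ => 2 * α) (a := a) (b := t)
    (h.continuousOn.mono fun r hr => ha.trans_le hr.1)
    (fun x hx => (h x (ha.trans_le hx.1)).hasDerivWithinAt) (by simp [h0])
    (fun x => ?_) (fun x hx hxe => ?_) ⟨hat, le_rfl⟩
  · have := (((hasDerivAt_id x).sub_const a).const_mul (2 * α)).const_add (-quarter p)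
    simpa using this
  · have hG : angleForce p (ϑ x) ≤ 0 := by
      refine angleForce_nonpos hp ⟨?_, ?_⟩
      · rw [hxe]; nlinarith [hx.1]
      · rw [hxe]; nlinarith [hx.2]
    have : 0 < x := ha.trans_le hx.1
    have : 0 ≤ K / x := by positivity
    simp only [angleField]
    nlinarith

/-! ### Angles started at `-π_p/2`, the singular time included -/

/-- `ϑ` solves the angle equation and starts at `-π_p/2` at time `a`, with the initial bounds
that also make sense at the singular time `a = 0`. -/
structure IsStart (p α K a : ℝ) (ϑ : ℝ → ℝ) : Prop where
  isAngle : IsAngle p α K 0 ϑ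
  ge : ∀ t, a < t → -quarter p ≤ ϑ t
  le : ∀ t, a < t → 2 * α * (t - a) ≤ quarter p → ϑ t ≤ -quarter p + 2 * α * (t - a)
  init : ϑ a = -quarter p

theorem exists_isStart_of_pos {p α K a : ℝ} (hp : 1 < p) (hα : 0 < α) (hK : 0 ≤ K) (ha : 0 < a) :
    ∃ ϑ, IsStart p α K a ϑ := by
  obtain ⟨ϑ, h0, h⟩ := exists_isAngle hp hα hK ha (-quarter p)
  exact ⟨ϑ, h, fun t ht => (h.lt_of_le hα (angleForce_neg_quarter hp) ha ht h0.ge).le,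
    fun t ht h2 => h.start_le hp hα hK ha h0 ht.le h2, h0⟩

/-- Stability near the singular time. -/
theorem exists_stability {p α K : ℝ} (hp : 1 < p) (hα : 0 < α) (hK : 0 ≤ K) :
    ∃ τ > 0, ∃ M, 0 ≤ M ∧ ∀ a₁ a₂ ϑ₁ ϑ₂ s t, 0 ≤ a₁ → 0 ≤ a₂ → a₁ ≤ s → a₂ ≤ s → 0 < s → s < τ →
      s < t → IsStart p α K a₁ ϑ₁ → IsStart p α K a₂ ϑ₂ →
      |ϑ₁ t - ϑ₂ t| ≤ 2 * α * s * exp (M * t) := by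
  obtain ⟨ρ, hρ, hanti⟩ := exists_antitoneOn_angleForce hp
  have hq := quarter_pos hp
  -- Up to time `τ` the angles rise by at most `2ατ`; this keeps them where the force is
  -- nonincreasing and where the initial bound `le` applies.
  set τ := min ρ (quarter p) / (2 * α) with hτ
  have hτ0 : 0 < τ := by positivity
  have hτ1 : 2 * α * τ ≤ ρ := by
    rw [hτ, mul_div_cancel₀ _ (by positivity)]; exact min_le_left _ _
  have hτ2 : 2 * α * τ ≤ quarter p := by
    rw [hτ, mul_div_cancel₀ _ (by positivity)]; exact min_le_right _ _
  have h0 : 0 ≤ K * p := by nlinarith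
  refine ⟨τ, hτ0, K * p / τ, by positivity, ?_⟩
  intro a₁ a₂ ϑ₁ ϑ₂ s t ha₁ ha₂ has₁ has₂ hs hsτ hst h₁ h₂
  have hbd : ∀ a ϑ, 0 ≤ a → IsStart p α K a ϑ → ∀ r, a ≤ r → r ≤ τ →
      -quarter p ≤ ϑ r ∧ ϑ r ≤ -quarter p + 2 * α * r := by
    intro a ϑ ha h r har hr
    rcases har.eq_or_lt with rfl | har
    · rw [h.init]; constructor
      · rfl
      · nlinarith
    · have h2 : 2 * α * (r - a) ≤ 2 * α * r := by gcongr; linarith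
      have h3 : 2 * α * r ≤ 2 * α * τ := by gcongr
      exact ⟨h.ge r har, (h.le r har (by linarith)).trans (by linarith)⟩
  have hmem : ∀ a ϑ, 0 ≤ a → a ≤ s → IsStart p α K a ϑ → ∀ r, s ≤ r → r ≤ τ →
      ϑ r ∈ Icc (-quarter p - ρ) (-quarter p + ρ) := by
    intro a ϑ ha has h r hsr hr
    have := hbd a ϑ ha h r (has.trans hsr) hr
    have h3 : 2 * α * r ≤ 2 * α * τ := by gcongr
    exact ⟨by linarith, by linarith⟩
  have hss : |ϑ₁ s - ϑ₂ s| ≤ 2 * α * s := by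
    have b1 := hbd a₁ ϑ₁ ha₁ h₁ s has₁ hsτ.le
    have b2 := hbd a₂ ϑ₂ ha₂ h₂ s has₂ hsτ.le
    rw [abs_le]; constructor <;> linarith
  have hsmall : ∀ r, s ≤ r → r ≤ τ → |ϑ₁ r - ϑ₂ r| ≤ 2 * α * s := fun r hsr hr =>
    (h₁.isAngle.dist_le_of_antitone hK le_rfl h₂.isAngle hanti hs hsr
      (fun x hx => hmem a₁ ϑ₁ ha₁ has₁ h₁ x hx.1 (hx.2.trans hr))
      (fun x hx => hmem a₂ ϑ₂ ha₂ has₂ h₂ x hx.1 (hx.2.trans hr))).trans hss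
  have hαs : 0 ≤ 2 * α * s := by positivity
  rcases le_total t τ with h | h
  · refine (hsmall t hst.le h).trans (le_mul_of_one_le_right hαs (Real.one_le_exp ?_))
    have : 0 < t := hs.trans hst
    positivity
  -- Beyond `τ`, Grönwall applies with the fixed constant `K p / τ`.
  · refine (h₁.isAngle.dist_le hp hK le_rfl h₂.isAngle hτ0 h).trans ?_
    gcongr
    · exact hsmall τ hsτ.le le_rfl
    · linarith

/-- Angles started at `1/(k+1)` form a Cauchy sequence by `exists_stability`. The convergence is
uniform near each `t > 0`, so the equation passes to the limit, and so do the initial bounds. -/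
theorem exists_isStart_zero {p α K : ℝ} (hp : 1 < p) (hα : 0 < α) (hK : 0 ≤ K) :
    ∃ ϑ, IsStart p α K 0 ϑ := by
  have hq := quarter_pos hp
  obtain ⟨τ, hτ, M, hM, hstab⟩ := exists_stability (p := p) (α := α) (K := K) hp hα hK
  set ε : ℕ → ℝ := fun k => 1 / ((k : ℝ) + 1) with hε
  have hε0 : ∀ k, 0 < ε k := fun k => by positivity
  have hεlim : Tendsto ε atTop (𝓝 0) := tendsto_one_div_add_atTop_nhds_zero_nat
  have hεanti : Antitone ε := fun i j hij => by
    have : (i : ℝ) ≤ j := by exact_mod_cast hij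
    simp only [hε]; gcongr
  choose φ hφ using fun k => exists_isStart_of_pos (p := p) (α := α) (K := K) hp hα hK (hε0 k)
  have hclose : ∀ t i j, i ≤ j → ε i < τ → ε i < t →
      |φ i t - φ j t| ≤ 2 * α * ε i * exp (M * t) := fun t i j hij h1 h2 =>
    hstab _ _ _ _ _ t (hε0 i).le (hε0 j).le le_rfl (hεanti hij) (hε0 i) h1 h2 (hφ i) (hφ j)
  have hclose_lim : ∀ t, Tendsto (fun k => 2 * α * ε k * exp (M * t)) atTop (𝓝 0) := fun t => by
    simpa using (hεlim.const_mul (2 * α)).mul_const (exp (M * t))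
  have hsm : ∀ t, 0 < t → ∀ᶠ k in atTop, ε k < τ ∧ ε k < t := fun t ht =>
    (hεlim.eventually_lt_const hτ).and (hεlim.eventually_lt_const ht)
  have hcauchy : ∀ t, 0 < t → ∃ l, Tendsto (fun k => φ k t) atTop (𝓝 l) := by
    intro t ht
    refine cauchySeq_tendsto_of_complete (Metric.cauchySeq_iff'.2 fun e he => ?_)
    obtain ⟨N, hN1, hN2⟩ := ((hsm t ht).and ((hclose_lim t).eventually_lt_const he)).exists
    refine ⟨N, fun n hn => ?_⟩
    rw [dist_comm, Real.dist_eq]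
    exact (hclose t N n hn hN1.1 hN1.2).trans_lt hN2
  choose! L hL using hcauchy
  set ψ : ℝ → ℝ := fun t => if 0 < t then L t else -quarter p with hψ
  have hψL : ∀ t, 0 < t → ψ t = L t := fun t ht => by simp [hψ, ht]
  have hlim : ∀ t, 0 < t → Tendsto (fun k => φ k t) atTop (𝓝 (ψ t)) := fun t ht => by
    rw [hψL t ht]; exact hL t ht
  have hrate : ∀ t i, ε i < τ → ε i < t → |φ i t - ψ t| ≤ 2 * α * ε i * exp (M * t) := by
    intro t i h1 h2
    refine le_of_tendsto (((hlim t ((hε0 i).trans h2)).const_sub (φ i t)).abs) ?_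
    filter_upwards [eventually_ge_atTop i] with j hj using hclose t i j hj h1 h2
  refine ⟨ψ, fun t ht => ?_, fun t ht => ?_, fun t ht h2 => ?_, by simp [hψ]⟩
  · have hunif : TendstoUniformlyOn (fun k s => angleField p α K s (φ k s))
        (fun s => angleField p α K s (ψ s)) atTop (Ioo (t / 2) (2 * t)) := by
      rw [Metric.tendstoUniformlyOn_iff]
      intro e he
      have hlim0 : Tendsto (fun k => K * p / (t / 2) * (2 * α * ε k * exp (M * (2 * t)))) atTop
          (𝓝 0) := by simpa using (hclose_lim (2 * t)).const_mul (K * p / (t / 2))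
      filter_upwards [hsm (t / 2) (by positivity), hlim0.eventually_lt_const he] with k hk1 hk2
      intro s hs
      have hs0 : 0 < s := lt_trans (by positivity) hs.1
      have h0 : 0 ≤ K * p := by nlinarith
      rw [dist_comm, Real.dist_eq]
      refine ((abs_angleField_sub_le hp hK hs0 _ _).trans ?_).trans_lt hk2
      have hr := hrate s k hk1.1 (hk1.2.trans hs.1)
      have : 0 < ε k := hε0 k
      have h3 : 2 * α * ε k * exp (M * s) ≤ 2 * α * ε k * exp (M * (2 * t)) := by
        gcongr; exact hs.2.le
      have h4 : K * p / s ≤ K * p / (t / 2) := by gcongr; exact hs.1.le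
      exact mul_le_mul h4 (hr.trans h3) (abs_nonneg _) (by positivity)
    exact hasDerivAt_of_tendstoUniformlyOn isOpen_Ioo hunif
      (Eventually.of_forall fun k s hs =>
        (hφ k).isAngle s (lt_trans (by positivity) hs.1))
      (fun s hs => hlim s (lt_trans (by positivity) hs.1)) ⟨by linarith, by linarith⟩
  · refine ge_of_tendsto (hlim t ht) ?_
    filter_upwards [hsm t ht] with k hk using (hφ k).ge t hk.2
  · refine le_of_tendsto (hlim t ht) ?_
    filter_upwards [hsm t ht] with k hk
    have h3 : 2 * α * (t - ε k) ≤ 2 * α * (t - 0) := by gcongr; exact (hε0 k).le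
    exact ((hφ k).le t hk.2 (h3.trans h2)).trans (by linarith)

theorem exists_isStart {p α K a : ℝ} (hp : 1 < p) (hα : 0 < α) (hK : 0 ≤ K) (ha : 0 ≤ a) :
    ∃ ϑ, IsStart p α K a ϑ := by
  rcases ha.eq_or_lt with rfl | ha
  · exact exists_isStart_zero hp hα hK
  · exact exists_isStart_of_pos hp hα hK ha

theorem IsStart.tendsto {p α K a : ℝ} {ϑ : ℝ → ℝ} (hp : 1 < p) (hα : 0 < α)
    (h : IsStart p α K a ϑ) : Tendsto ϑ (𝓝[>] a) (𝓝 (-quarter p)) := by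
  have hq := quarter_pos hp
  have hlim : Tendsto (fun t => -quarter p + 2 * α * (t - a)) (𝓝[>] a) (𝓝 (-quarter p)) := by
    have hc : Continuous fun t : ℝ => -quarter p + 2 * α * (t - a) := by fun_prop
    have := hc.tendsto a
    simp only [sub_self, mul_zero, add_zero] at this
    exact this.mono_left nhdsWithin_le_nhds
  refine tendsto_of_tendsto_of_tendsto_of_le_of_le' tendsto_const_nhds hlim ?_ ?_
  · filter_upwards [self_mem_nhdsWithin] with t ht using h.ge t ht
  · have : a < a + quarter p / (2 * α) := by
      have : 0 < quarter p / (2 * α) := by positivity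
      linarith
    filter_upwards [Ioo_mem_nhdsGT this] with t ht
    refine h.le t ht.1 ?_
    have h2 : t - a ≤ quarter p / (2 * α) := by linarith [ht.2]
    rw [le_div_iff₀ (by positivity)] at h2
    linarith

theorem IsStart.gt {p α K a t : ℝ} {ϑ : ℝ → ℝ} (hp : 1 < p) (hα : 0 < α) (ha : 0 ≤ a)
    (h : IsStart p α K a ϑ) (ht : a < t) : -quarter p < ϑ t := by
  obtain ⟨s, hs1, hs2⟩ := exists_between ht
  exact h.isAngle.lt_of_le hα (angleForce_neg_quarter hp) (ha.trans_lt hs1) hs2 (h.ge s hs1)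

/-- Continuous dependence on the initial time. -/
theorem tendsto_isStart {p α K a₀ t : ℝ} {Θ : ℝ → ℝ → ℝ} (hp : 1 < p) (hα : 0 < α) (hK : 0 ≤ K)
    (hΘ : ∀ a, 0 ≤ a → IsStart p α K a (Θ a)) (ha₀ : 0 ≤ a₀) (ht : a₀ < t) :
    Tendsto (fun a => Θ a t) (𝓝[Ici 0] a₀) (𝓝 (Θ a₀ t)) := by
  rw [tendsto_iff_dist_tendsto_zero]
  rcases ha₀.eq_or_lt with rfl | ha₀
  · obtain ⟨τ, hτ, M, hM, hstab⟩ := exists_stability (p := p) (α := α) (K := K) hp hα hK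
    have hlim : Tendsto (fun a : ℝ => 2 * α * a * exp (M * t)) (𝓝[Ici 0] 0) (𝓝 0) := by
      have hc : Continuous fun a : ℝ => 2 * α * a * exp (M * t) := by fun_prop
      have := hc.tendsto 0
      simp only [mul_zero, zero_mul] at this
      exact this.mono_left nhdsWithin_le_nhds
    refine squeeze_zero' (Eventually.of_forall fun _ => dist_nonneg) ?_ hlim
    filter_upwards [self_mem_nhdsWithin,
      mem_nhdsWithin_of_mem_nhds (Iio_mem_nhds (lt_min hτ ht))] with a ha1 ha2
    have ha1 : 0 ≤ a := ha1
    rcases ha1.eq_or_lt with rfl | ha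
    · simp
    · exact hstab _ _ _ _ a t ha.le le_rfl le_rfl ha.le ha (lt_of_lt_of_le ha2 (min_le_left _ _))
        (lt_of_lt_of_le ha2 (min_le_right _ _)) (hΘ a ha.le) (hΘ 0 le_rfl)
  · have h₀ := hΘ a₀ ha₀.le
    have h0 : 0 ≤ K * p := by nlinarith
    -- For `a₀ > 0` the angle started at `a₀` exists on all of `(0, ∞)`, so at time `a`, on either
    -- side of `a₀`, it can be compared with `-q`, the starting value of the other.
    have hlim : Tendsto (fun a : ℝ => |-quarter p - Θ a₀ a| * exp (K * p / (a₀ / 2) * t))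
        (𝓝[Ici 0] a₀) (𝓝 0) := by
      have hc : Tendsto (Θ a₀) (𝓝 a₀) (𝓝 (Θ a₀ a₀)) :=
        (h₀.isAngle a₀ ha₀).continuousAt.tendsto
      have := ((hc.const_sub (-quarter p)).abs).mul_const (exp (K * p / (a₀ / 2) * t))
      rw [h₀.init, sub_self, abs_zero, zero_mul] at this
      exact this.mono_left nhdsWithin_le_nhds
    refine squeeze_zero' (Eventually.of_forall fun _ => dist_nonneg) ?_ hlim
    filter_upwards [mem_nhdsWithin_of_mem_nhds (Ioo_mem_nhds (by linarith : a₀ / 2 < a₀) ht)] with a ha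
    have ha0 : 0 < a := lt_trans (by positivity) ha.1
    have h := hΘ a ha0.le
    rw [Real.dist_eq]
    refine (h.isAngle.dist_le hp hK le_rfl h₀.isAngle ha0 ha.2.le).trans ?_
    rw [h.init]
    have ht0 : 0 < t := ha₀.trans ht
    gcongr
    · linarith [ha.2]
    · exact ha.1.le
    · linarith
theorem eq_of_hasDerivAt_zero_of_tendsto {f : ℝ → ℝ} {a l : ℝ}
    (hf : ∀ t, a < t → HasDerivAt f 0 t) (hl : Tendsto f (𝓝[>] a) (𝓝 l)) {t : ℝ} (ht : a < t) :
    f t = l := by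
  have hconst : EqOn f (fun _ => f t) (Ioi a) :=
    isOpen_Ioi.eqOn_of_deriv_eq isPreconnected_Ioi
      (fun s hs => (hf s hs).differentiableAt.differentiableWithinAt)
      (differentiableOn_const _) (fun s hs => by rw [(hf s hs).deriv, deriv_const])
      (show t ∈ Ioi a from ht) rfl
  refine tendsto_nhds_unique (tendsto_const_nhds.congr' ?_) hl
  filter_upwards [self_mem_nhdsWithin] with s hs using (hconst hs).symm

/-! ### The time at which the angle reaches `π_p/2` -/

/-- The primitive of the force vanishing at `±π_p/2`. -/
def forcePrimitive (p θ : ℝ) : ℝ := ∫ x in (-quarter p)..θ, angleForce p x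

theorem hasDerivAt_forcePrimitive {p : ℝ} (hp : 1 < p) (θ : ℝ) :
    HasDerivAt (forcePrimitive p) (angleForce p θ) θ :=
  intervalIntegral.integral_hasDerivAt_right ((continuous_angleForce hp).intervalIntegrable _ _)
    ((continuous_angleForce hp).stronglyMeasurableAtFilter _ _)
    (continuous_angleForce hp).continuousAt

theorem forcePrimitive_neg_quarter (p : ℝ) : forcePrimitive p (-quarter p) = 0 := by
  simp [forcePrimitive]

theorem forcePrimitive_neg {p : ℝ} (hp : 1 < p) (θ : ℝ) :
    forcePrimitive p (-θ) = forcePrimitive p θ := by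
  have hi : ∀ a b, IntervalIntegrable (angleForce p) volume a b := fun a b =>
    (continuous_angleForce hp).intervalIntegrable a b
  have h1 := intervalIntegral.integral_add_adjacent_intervals (hi (-quarter p) (-θ)) (hi (-θ) θ)
  have h2 := intervalIntegral.integral_comp_neg (a := -θ) (b := θ) (angleForce p)
  simp only [angleForce_neg hp, intervalIntegral.integral_neg, neg_neg] at h2
  unfold forcePrimitive
  linarith

theorem forcePrimitive_quarter {p : ℝ} (hp : 1 < p) : forcePrimitive p (quarter p) = 0 := by
  rw [← forcePrimitive_neg hp, forcePrimitive_neg_quarter]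

theorem forcePrimitive_neg_of_mem {p θ : ℝ} (hp : 1 < p) (h : θ ∈ Ioo (-quarter p) (quarter p)) :
    forcePrimitive p θ < 0 := by
  have hq := quarter_pos hp
  have hanti : StrictAntiOn (forcePrimitive p) (Icc (-quarter p) 0) := by
    refine strictAntiOn_of_deriv_neg (convex_Icc _ _)
      (fun x _ => (hasDerivAt_forcePrimitive hp x).continuousAt.continuousWithinAt) ?_
    intro x hx
    rw [interior_Icc] at hx
    rw [(hasDerivAt_forcePrimitive hp x).deriv]
    have := angleForce_pos hp (θ := -x) ⟨by linarith [hx.2], by linarith [hx.1]⟩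
    rw [angleForce_neg hp] at this
    linarith
  have key : ∀ x ∈ Ioc (-quarter p) 0, forcePrimitive p x < 0 := by
    intro x hx
    have := hanti ⟨le_rfl, by linarith⟩ ⟨hx.1.le, hx.2⟩ hx.1
    rwa [forcePrimitive_neg_quarter] at this
  rcases le_total θ 0 with h0 | h0
  · exact key θ ⟨h.1, h0⟩
  · rw [← forcePrimitive_neg hp]
    exact key (-θ) ⟨by linarith [h.2], by linarith⟩

/-- The force vanishes at `-q` and is `p`-Lipschitz. This quadratic vanishing beats the factor `1/t`
when `a = 0`. -/
theorem abs_forcePrimitive_le {p θ : ℝ} (hp : 1 < p) (h : -quarter p ≤ θ) :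
    |forcePrimitive p θ| ≤ p * (θ + quarter p) ^ 2 := by
  have hb : ∀ x ∈ uIoc (-quarter p) θ, ‖angleForce p x‖ ≤ p * (θ + quarter p) := by
    intro x hx
    rw [uIoc_of_le h] at hx
    have h1 := abs_angleForce_sub_le hp x (-quarter p)
    rw [angleForce_neg_quarter hp, sub_zero, abs_of_nonneg (by linarith [hx.1] :
      0 ≤ x - -quarter p)] at h1
    rw [Real.norm_eq_abs]
    refine h1.trans ?_
    gcongr
    linarith [hx.2]
  have := intervalIntegral.norm_integral_le_of_norm_le_const hb
  rw [abs_of_nonneg (by linarith : 0 ≤ θ - -quarter p)] at this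
  refine this.trans (le_of_eq ?_)
  ring

/-- `b` is the time at which the angle `ϑ`, started at time `a`, reaches `π_p/2`. -/
structure IsHit (p a b : ℝ) (ϑ : ℝ → ℝ) : Prop where
  lt : a < b
  eq : ϑ b = quarter p
  before : ∀ t, a < t → t < b → ϑ t < quarter p
  after : ∀ t, b < t → quarter p < ϑ t

theorem exists_isHit {p α K a : ℝ} {ϑ : ℝ → ℝ} (hp : 1 < p) (hα : 0 < α) (hK : 0 ≤ K)
    (ha : 0 ≤ a) (h : IsStart p α K a ϑ) : ∃ b, IsHit p a b ϑ := by
  have hq := quarter_pos hp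
  have hang := h.isAngle.mono ha
  -- After `T` one has `K/t ≤ α/2`, so the slope is at least `α/2`; the further time `4q/α` then
  -- yields a rise of `2q`.
  set T := max (a + 1) (2 * K / α) with hT
  have hT1 : a + 1 ≤ T := le_max_left _ _
  have hT2 : 2 * K / α ≤ T := le_max_right _ _
  have hT0 : 0 < T := by linarith
  set u := T + 4 * quarter p / α with hu
  have hTu : T ≤ u := by
    have : 0 ≤ 4 * quarter p / α := by positivity
    linarith
  have hgrow : α / 2 * (u - T) ≤ ϑ u - ϑ T := by
    refine Convex.mul_sub_le_image_sub_of_le_deriv (convex_Icc T u)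
      (hang.continuousOn.mono fun t ht => lt_of_lt_of_le (by linarith) ht.1)
      (fun t ht => ?_) (fun t ht => ?_) T ⟨le_rfl, hTu⟩ u ⟨hTu, le_rfl⟩ hTu
    · rw [interior_Icc] at ht
      exact (hang t (by linarith [ht.1])).differentiableAt.differentiableWithinAt
    · rw [interior_Icc] at ht
      rw [(hang t (by linarith [ht.1])).deriv, angleField]
      have ht0 : 0 < t := hT0.trans ht.1
      have h1 : K / t ≤ α / 2 := by
        rw [div_le_iff₀ ht0]
        have : 2 * K ≤ T * α := by rwa [div_le_iff₀ hα] at hT2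
        nlinarith [ht.1]
      have h2 : 0 ≤ K / t := by positivity
      have h3 := neg_le_of_abs_le (abs_angleForce_le_one hp (ϑ t))
      nlinarith
  have hu1 : quarter p ≤ ϑ u := by
    have h1 : α / 2 * (u - T) = 2 * quarter p := by rw [hu]; field_simp; ring
    have h2 := h.ge T (by linarith)
    linarith
  have hstart : ∀ᶠ t in 𝓝[>] a, ϑ t < quarter p :=
    (h.tendsto hp hα).eventually_lt_const (by linarith)
  obtain ⟨s, hs1, hs2⟩ := (hstart.and (Ioo_mem_nhdsGT (by linarith : a < u))).exists
  obtain ⟨b, hb1, hb2⟩ := intermediate_value_Icc hs2.2.le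
    (hang.continuousOn.mono fun t ht => hs2.1.trans_le ht.1)
    (show quarter p ∈ _ from ⟨hs1.le, hu1⟩)
  refine ⟨b, hs2.1.trans_le hb1.1, hb2, fun t ht1 ht2 => ?_, fun t ht => ?_⟩
  · by_contra hcon
    have := hang.lt_of_le hα (angleForce_quarter hp) ht1 ht2 (not_lt.1 hcon)
    exact this.ne' hb2
  · exact hang.lt_of_le hα (angleForce_quarter hp) (hs2.1.trans_le hb1.1) ht hb2.ge

theorem tendsto_forcePrimitive_div {p α K a : ℝ} {ϑ : ℝ → ℝ} (hp : 1 < p) (hα : 0 < α)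
    (ha : 0 ≤ a) (h : IsStart p α K a ϑ) :
    Tendsto (fun t => forcePrimitive p (ϑ t) / t) (𝓝[>] a) (𝓝 0) := by
  have hq := quarter_pos hp
  have hlim : Tendsto (fun t : ℝ => 4 * p * α ^ 2 * (t - a)) (𝓝[>] a) (𝓝 0) := by
    have hc : Continuous fun t : ℝ => 4 * p * α ^ 2 * (t - a) := by fun_prop
    have := hc.tendsto a
    simp only [sub_self, mul_zero] at this
    exact this.mono_left nhdsWithin_le_nhds
  refine squeeze_zero_norm' ?_ hlim
  have : a < a + quarter p / (2 * α) := by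
    have : 0 < quarter p / (2 * α) := by positivity
    linarith
  filter_upwards [Ioo_mem_nhdsGT this] with t ht
  have ht0 : 0 < t := ha.trans_lt ht.1
  have h2 : t - a ≤ quarter p / (2 * α) := by linarith [ht.2]
  rw [le_div_iff₀ (by positivity)] at h2
  have h3 := h.le t ht.1 (by linarith)
  have h4 := h.ge t ht.1
  have h5 := abs_forcePrimitive_le hp h4
  have h6 : (ϑ t + quarter p) ^ 2 ≤ (2 * α * (t - a)) ^ 2 :=
    pow_le_pow_left₀ (by linarith) (by linarith) 2
  rw [Real.norm_eq_abs, abs_div, abs_of_pos ht0, div_le_iff₀ ht0]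
  have h7 : 0 ≤ t - a := by linarith [ht.1]
  calc |forcePrimitive p (ϑ t)| ≤ p * (2 * α * (t - a)) ^ 2 := h5.trans (by gcongr)
    _ = 4 * p * α ^ 2 * (t - a) * (t - a) := by ring
    _ ≤ 4 * p * α ^ 2 * (t - a) * t := by
      have : 0 ≤ 4 * p * α ^ 2 * (t - a) := by positivity
      gcongr
      linarith

/-- The damping delays the angle. -/
theorem IsHit.two_quarter_lt {p α K a b : ℝ} {ϑ : ℝ → ℝ} (hp : 1 < p) (hα : 0 < α) (hK : 0 < K)
    (ha : 0 ≤ a) (h : IsStart p α K a ϑ) (hb : IsHit p a b ϑ) :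
    2 * quarter p < α * (b - a) := by
  -- In the derivative of `αt - ϑ` the term `-(K/t) G(ϑ)` has no sign. The correction `(K/α) F(ϑ)/t`
  -- cancels it and leaves `(K/α)(K G² - F)/t²`, positive because `F < 0`.
  set Φ : ℝ → ℝ := fun t => α * t - ϑ t + K / α * (forcePrimitive p (ϑ t) / t) with hΦ
  have hd : ∀ t, a < t → HasDerivAt Φ
      (K / α * ((K * angleForce p (ϑ t) ^ 2 - forcePrimitive p (ϑ t)) / t ^ 2)) t := by
    intro t ht
    have ht0 : 0 < t := ha.trans_lt ht
    have h1 := h.isAngle t ht0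
    have h2 := ((hasDerivAt_forcePrimitive hp (ϑ t)).comp t h1).div (hasDerivAt_id t) ht0.ne'
    refine ((((hasDerivAt_id t).const_mul α).sub h1).add (h2.const_mul (K / α))).congr_deriv ?_
    simp only [angleField, id, Function.comp_apply]
    field_simp
    ring
  have hmono : StrictMonoOn Φ (Ioc a b) := by
    refine strictMonoOn_of_deriv_pos (convex_Ioc _ _)
      (fun t ht => (hd t ht.1).continuousAt.continuousWithinAt) ?_
    intro t ht
    rw [interior_Ioc] at ht
    rw [(hd t ht.1).deriv]
    have ht0 : 0 < t := ha.trans_lt ht.1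
    have h1 := forcePrimitive_neg_of_mem hp ⟨h.gt hp hα ha ht.1, hb.before t ht.1 ht.2⟩
    have h2 : 0 < K * angleForce p (ϑ t) ^ 2 - forcePrimitive p (ϑ t) := by
      have : 0 ≤ K * angleForce p (ϑ t) ^ 2 := by positivity
      linarith
    positivity
  have hlim : Tendsto Φ (𝓝[>] a) (𝓝 (α * a + quarter p)) := by
    have h1 : Tendsto (fun t : ℝ => α * t) (𝓝[>] a) (𝓝 (α * a)) :=
      ((continuous_const.mul continuous_id).tendsto a).mono_left nhdsWithin_le_nhds
    have := (h1.sub (h.tendsto hp hα)).add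
      ((tendsto_forcePrimitive_div hp hα ha h).const_mul (K / α))
    simpa using this
  obtain ⟨m, hm1, hm2⟩ := exists_between hb.lt
  have h1 : α * a + quarter p ≤ Φ m := by
    refine le_of_tendsto hlim ?_
    filter_upwards [Ioo_mem_nhdsGT hm1] with t ht
    exact (hmono ⟨ht.1, (ht.2.trans hm2).le⟩ ⟨hm1, hm2.le⟩ ht.2).le
  have h2 : Φ m < Φ b := hmono ⟨hm1, hm2.le⟩ ⟨hb.lt, le_rfl⟩ hm2
  have h3 : Φ b = α * b - quarter p := by
    simp only [hΦ, hb.eq, forcePrimitive_quarter hp]; ring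
  linarith

theorem IsHit.two_quarter_eq {p α a b : ℝ} {ϑ : ℝ → ℝ} (hp : 1 < p) (hα : 0 < α)
    (ha : 0 ≤ a) (h : IsStart p α 0 a ϑ) (hb : IsHit p a b ϑ) :
    α * (b - a) = 2 * quarter p := by
  have hlim : Tendsto (fun t => ϑ t - α * t) (𝓝[>] a) (𝓝 (-quarter p - α * a)) :=
    (h.tendsto hp hα).sub
      (((continuous_const.mul continuous_id).tendsto a).mono_left nhdsWithin_le_nhds)
  have := eq_of_hasDerivAt_zero_of_tendsto (f := fun t => ϑ t - α * t) (fun t ht => ?_) hlim hb.lt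
  · rw [hb.eq] at this; linarith
  · refine ((h.isAngle t (ha.trans_lt ht)).sub ((hasDerivAt_id t).const_mul α)).congr_deriv ?_
    simp [angleField]

/-- As `|G| ≤ 1`, the slope of the angle is at least `α - K/a` after time `a`. -/
theorem IsHit.sub_mul_le {p α K a b : ℝ} {ϑ : ℝ → ℝ} (hp : 1 < p) (hK : 0 ≤ K)
    (ha : 0 < a) (h : IsStart p α K a ϑ) (hb : IsHit p a b ϑ) :
    (α - K / a) * (b - a) ≤ 2 * quarter p := by
  have hg : (α - K / a) * (b - a) ≤ ϑ b - ϑ a := by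
    refine Convex.mul_sub_le_image_sub_of_le_deriv (convex_Icc a b)
      (h.isAngle.continuousOn.mono fun t ht => ha.trans_le ht.1)
      (fun t ht => ?_) (fun t ht => ?_) a ⟨le_rfl, hb.lt.le⟩ b ⟨hb.lt.le, le_rfl⟩ hb.lt.le
    · rw [interior_Icc] at ht
      exact (h.isAngle t (ha.trans ht.1)).differentiableAt.differentiableWithinAt
    · rw [interior_Icc] at ht
      rw [(h.isAngle t (ha.trans ht.1)).deriv, angleField]
      have ht0 : 0 < t := ha.trans ht.1
      have h1 : K / t ≤ K / a := by gcongr; exact ht.1.le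
      have h2 : 0 ≤ K / t := by positivity
      have h3 := neg_le_of_abs_le (abs_angleForce_le_one hp (ϑ t))
      nlinarith
  rw [hb.eq, h.init] at hg
  linarith

/-- Whether `b a` lies before or after a time `t` is read off from the side of `q` on which `Θ a t`
lies, so convergence at one time on each side of `b a₀` suffices. -/
theorem continuousOn_hit {p α K : ℝ} {Θ : ℝ → ℝ → ℝ} {b : ℝ → ℝ} (hp : 1 < p) (hα : 0 < α)
    (hK : 0 ≤ K) (hΘ : ∀ a, 0 ≤ a → IsStart p α K a (Θ a))
    (hb : ∀ a, 0 ≤ a → IsHit p a (b a) (Θ a)) : ContinuousOn b (Ici 0) := by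
  intro a₀ ha₀
  have ha₀ : 0 ≤ a₀ := ha₀
  have h0 := hb a₀ ha₀
  refine tendsto_order.2 ⟨fun l hl => ?_, fun u hu => ?_⟩
  · obtain ⟨t, ht1, ht2⟩ := exists_between (max_lt hl h0.lt)
    have hat : a₀ < t := (le_max_right _ _).trans_lt ht1
    filter_upwards [(tendsto_isStart hp hα hK hΘ ha₀ hat).eventually_lt_const
      (h0.before t hat ht2), self_mem_nhdsWithin] with a ha1 ha2
    have : t ≤ b a := by
      by_contra hcon
      exact lt_asymm ((hb a ha2).after t (not_le.1 hcon)) ha1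
    exact ((le_max_left _ _).trans_lt ht1).trans_le this
  · obtain ⟨t, ht1, ht2⟩ := exists_between hu
    have hat : a₀ < t := h0.lt.trans ht1
    filter_upwards [(tendsto_isStart hp hα hK hΘ ha₀ hat).eventually_const_lt (h0.after t ht1),
      self_mem_nhdsWithin, mem_nhdsWithin_of_mem_nhds (Iio_mem_nhds hat)] with a ha1 ha2 ha3
    have : b a ≤ t := by
      by_contra hcon
      exact lt_asymm ((hb a ha2).before t ha3 (not_le.1 hcon)) ha1
    exact this.trans_lt ht2

/-! ### The amplitude and the construction of solutions -/

theorem alpha_pos {p lam : ℝ} (hp : 1 < p) (hlam : 0 < lam) : 0 < alpha p lam := by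
  have : 0 < p - 1 := by linarith
  unfold alpha; positivity

theorem sub_one_mul_alpha_rpow {p lam : ℝ} (hp : 1 < p) (hlam : 0 < lam) :
    (p - 1) * alpha p lam ^ p = lam := by
  have h1 : 0 < p - 1 := by linarith
  rw [alpha, ← Real.rpow_mul (by positivity), one_div_mul_cancel (by linarith), Real.rpow_one]
  field_simp

/-- The logarithmic decay rate of the amplitude, up to the factor `-K`. -/
def decayRate (p : ℝ) (ϑ : ℝ → ℝ) (t : ℝ) : ℝ := |pCos p (ϑ t)| ^ p / t

/-- The amplitude of the solution with angle `ϑ`. -/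
def amplitude (p K a : ℝ) (ϑ : ℝ → ℝ) (t : ℝ) : ℝ :=
  exp (-K * ∫ s in a..t, decayRate p ϑ s)

theorem amplitude_pos (p K a : ℝ) (ϑ : ℝ → ℝ) (t : ℝ) : 0 < amplitude p K a ϑ t := exp_pos _

theorem amplitude_self (p K a : ℝ) (ϑ : ℝ → ℝ) : amplitude p K a ϑ a = 1 := by
  simp [amplitude]

theorem abs_pCos_rpow_le_one {p : ℝ} (hp : 1 < p) (θ : ℝ) : |pCos p θ| ^ p ≤ 1 :=
  Real.rpow_le_one (abs_nonneg _) (abs_pCos_le_one hp θ) (by linarith)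

/-- `|C|^p = C C^{(p-1)}` is at most the modulus of the flux, which is `(p-1)`-Lipschitz and
vanishes at `-q`. -/
theorem abs_pCos_rpow_le {p : ℝ} (hp : 1 < p) (θ : ℝ) :
    |pCos p θ| ^ p ≤ (p - 1) * |θ + quarter p| := by
  have h1 : |pCos p θ| ^ p ≤ |pFlux p θ| := by
    rw [← pCos_mul_pFlux hp]
    refine (le_abs_self _).trans ?_
    rw [abs_mul]
    exact mul_le_of_le_one_left (abs_nonneg _) (abs_pCos_le_one hp θ)
  have h2 := Convex.norm_image_sub_le_of_norm_hasDerivWithin_le (f := pFlux p) (s := univ)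
    (C := p - 1) (fun θ _ => (hasDerivAt_pFlux hp θ).hasDerivWithinAt)
    (fun θ _ => by
      have h3 : |pSin p θ| ^ (p - 1) ≤ 1 :=
        Real.rpow_le_one (abs_nonneg _) (abs_pSin_le_one hp θ) (by linarith)
      rw [norm_mul, norm_neg, Real.norm_of_nonneg (by linarith : 0 ≤ p - 1), Real.norm_eq_abs,
        abs_spow (by linarith)]
      exact mul_le_of_le_one_right (by linarith) h3) convex_univ
    (mem_univ (-quarter p)) (mem_univ θ)
  rw [pFlux_eq_zero_of_pCos hp (pCos_neg_quarter hp), sub_zero, sub_neg_eq_add] at h2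
  exact h1.trans h2

theorem decayRate_nonneg {p t : ℝ} (ϑ : ℝ → ℝ) (ht : 0 < t) : 0 ≤ decayRate p ϑ t := by
  unfold decayRate; positivity

theorem continuousOn_decayRate {p α K a : ℝ} {ϑ : ℝ → ℝ} (hp : 1 < p) (ha : 0 ≤ a)
    (h : IsStart p α K a ϑ) : ContinuousOn (decayRate p ϑ) (Ioi a) := by
  intro t ht
  have ht0 : 0 < t := ha.trans_lt ht
  exact ((((continuous_pCos hp).continuousAt.comp
    (h.isAngle t ht0).continuousAt).abs.rpow_const (Or.inr (by linarith))).div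
    continuousAt_id ht0.ne').continuousWithinAt

theorem exists_decayRate_le {p α K a : ℝ} {ϑ : ℝ → ℝ} (hp : 1 < p) (hα : 0 < α) (ha : 0 ≤ a)
    (h : IsStart p α K a ϑ) : ∃ M, ∀ t, a < t → |decayRate p ϑ t| ≤ M := by
  have hq := quarter_pos hp
  -- Early on, `|C|^p` is at most `(p-1) 2α t`, which absorbs the `1/t`; later `t ≥ q/(2α)` and
  -- `|C|^p ≤ 1`.
  refine ⟨max ((p - 1) * (2 * α)) (2 * α / quarter p), fun t ht => ?_⟩
  have ht0 : 0 < t := ha.trans_lt ht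
  rw [abs_of_nonneg (decayRate_nonneg ϑ ht0), decayRate, div_le_iff₀ ht0]
  rcases le_total (2 * α * (t - a)) (quarter p) with h1 | h1
  · have h2 := h.le t ht h1
    have h3 := h.ge t ht
    refine (abs_pCos_rpow_le hp _).trans ?_
    rw [abs_of_nonneg (by linarith)]
    calc (p - 1) * (ϑ t + quarter p) ≤ (p - 1) * (2 * α * t) := by
          have : 0 ≤ p - 1 := by linarith
          gcongr
          nlinarith
      _ = (p - 1) * (2 * α) * t := by ring
      _ ≤ _ := by gcongr; exact le_max_left _ _
  · refine (abs_pCos_rpow_le_one hp _).trans ?_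
    calc (1 : ℝ) = 2 * α / quarter p * (quarter p / (2 * α)) := by field_simp
      _ ≤ 2 * α / quarter p * t := by
          gcongr
          rw [div_le_iff₀ (by positivity)]
          nlinarith
      _ ≤ _ := by gcongr; exact le_max_right _ _

theorem intervalIntegrable_decayRate {p α K a t : ℝ} {ϑ : ℝ → ℝ} (hp : 1 < p) (hα : 0 < α)
    (ha : 0 ≤ a) (h : IsStart p α K a ϑ) (ht : a ≤ t) :
    IntervalIntegrable (decayRate p ϑ) volume a t := by
  obtain ⟨M, hM⟩ := exists_decayRate_le hp hα ha h
  rw [intervalIntegrable_iff_integrableOn_Ioc_of_le ht]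
  refine ⟨((continuousOn_decayRate hp ha h).mono Ioc_subset_Ioi_self).aestronglyMeasurable
    measurableSet_Ioc, .restrict_of_bounded (C := M) measure_Ioc_lt_top ?_⟩
  rw [ae_restrict_iff' measurableSet_Ioc]
  exact Eventually.of_forall fun s hs => hM s hs.1

theorem hasDerivAt_amplitude {p α K a t : ℝ} {ϑ : ℝ → ℝ} (hp : 1 < p) (hα : 0 < α)
    (ha : 0 ≤ a) (h : IsStart p α K a ϑ) (ht : a < t) :
    HasDerivAt (amplitude p K a ϑ) (-K * decayRate p ϑ t * amplitude p K a ϑ t) t := by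
  have hd : HasDerivAt (fun u => ∫ s in a..u, decayRate p ϑ s) (decayRate p ϑ t) t :=
    intervalIntegral.integral_hasDerivAt_right (intervalIntegrable_decayRate hp hα ha h ht.le)
      ((continuousOn_decayRate hp ha h).stronglyMeasurableAtFilter isOpen_Ioi t ht)
      ((continuousOn_decayRate hp ha h).continuousAt (Ioi_mem_nhds ht))
  refine (hd.const_mul (-K)).exp.congr_deriv ?_
  rw [amplitude]; ring

theorem tendsto_amplitude {p α K a : ℝ} {ϑ : ℝ → ℝ} (hp : 1 < p) (hα : 0 < α)
    (ha : 0 ≤ a) (h : IsStart p α K a ϑ) :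
    Tendsto (amplitude p K a ϑ) (𝓝[>] a) (𝓝 1) := by
  obtain ⟨M, hM⟩ := exists_decayRate_le hp hα ha h
  have hi : Tendsto (fun t => ∫ s in a..t, decayRate p ϑ s) (𝓝[>] a) (𝓝 0) := by
    have hlim : Tendsto (fun t : ℝ => M * |t - a|) (𝓝[>] a) (𝓝 0) := by
      have hc : Continuous fun t : ℝ => M * |t - a| := by fun_prop
      have := hc.tendsto a
      simp only [sub_self, abs_zero, mul_zero] at this
      exact this.mono_left nhdsWithin_le_nhds
    refine squeeze_zero_norm' ?_ hlim
    filter_upwards [self_mem_nhdsWithin] with t ht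
    have ht : a < t := ht
    refine intervalIntegral.norm_integral_le_of_norm_le_const fun s hs => ?_
    rw [uIoc_of_le ht.le] at hs
    exact hM s hs.1
  have := (Real.continuous_exp.tendsto _).comp (hi.const_mul (-K))
  rw [mul_zero, Real.exp_zero] at this
  exact this

/-- The solution with angle `ϑ`. -/
def wave (p K a : ℝ) (ϑ : ℝ → ℝ) (t : ℝ) : ℝ := amplitude p K a ϑ t * pSin p (ϑ t)

/-- The decay of the amplitude and the force term of the angle contribute opposite multiples of `S
|C|^p`, which cancel. -/
theorem hasDerivAt_wave {p α K a t : ℝ} {ϑ : ℝ → ℝ} (hp : 1 < p) (hα : 0 < α)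
    (ha : 0 ≤ a) (h : IsStart p α K a ϑ) (ht : a < t) :
    HasDerivAt (wave p K a ϑ) (α * amplitude p K a ϑ t * pCos p (ϑ t)) t := by
  have ht0 : 0 < t := ha.trans_lt ht
  refine ((hasDerivAt_amplitude hp hα ha h ht).mul
    ((hasDerivAt_pSin hp (ϑ t)).comp t (h.isAngle t ht0))).congr_deriv ?_
  simp only [angleField, angleForce, decayRate, ← pCos_mul_pFlux hp, Function.comp_apply]
  field_simp
  ring

theorem spow_deriv_wave {p α K a t : ℝ} {ϑ : ℝ → ℝ} (hp : 1 < p) (hα : 0 < α)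
    (ha : 0 ≤ a) (h : IsStart p α K a ϑ) (ht : a < t) :
    signedPow p (deriv (wave p K a ϑ) t)
      = (α * amplitude p K a ϑ t) ^ (p - 1) * pFlux p (ϑ t) := by
  rw [(hasDerivAt_wave hp hα ha h ht).deriv, signedPow_eq_spow,
    spow_const_mul (mul_pos hα (amplitude_pos _ _ _ _ _)), spow_pCos hp]

theorem isSolution_wave {p lam n a : ℝ} {ϑ : ℝ → ℝ} (hp : 1 < p) (hlam : 0 < lam) (ha : 0 ≤ a)
    (h : IsStart p (alpha p lam) ((n - 1) / (p - 1)) a ϑ) :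
    IsSolution p lam (damping n) a (wave p ((n - 1) / (p - 1)) a ϑ) := by
  set α := alpha p lam with hαdef
  set K := (n - 1) / (p - 1) with hKdef
  have hα : 0 < α := alpha_pos hp hlam
  have hp1 : 0 < p - 1 := by linarith
  have hd := fun t (ht : a < t) => hasDerivAt_wave hp hα ha h ht
  have hlimw : Tendsto (wave p K a ϑ) (𝓝[>] a) (𝓝 (-1)) := by
    have := (tendsto_amplitude hp hα ha h).mul
      (((continuous_pSin hp).tendsto _).comp (h.tendsto hp hα))
    rw [pSin_neg_quarter hp, one_mul] at this
    exact this
  have hlimd : Tendsto (deriv (wave p K a ϑ)) (𝓝[>] a) (𝓝 0) := by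
    have := ((tendsto_amplitude hp hα ha h).const_mul α).mul
      (((continuous_pCos hp).tendsto _).comp (h.tendsto hp hα))
    simp only [pCos_neg_quarter hp, mul_zero] at this
    refine this.congr' ?_
    filter_upwards [self_mem_nhdsWithin] with t ht using (hd t ht).deriv.symm
  have hinit : wave p K a ϑ a = -1 := by
    rw [wave, amplitude_self, h.init, pSin_neg_quarter hp]; ring
  refine ⟨hinit, ?_, ?_, ?_⟩
  · refine hasDerivWithinAt_Ici_of_tendsto_deriv (s := Ioi a)
      (fun t ht => (hd t ht).differentiableAt.differentiableWithinAt) ?_ self_mem_nhdsWithin hlimd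
    rw [ContinuousWithinAt, hinit]
    exact hlimw
  · refine (contDiffOn_one_iff_derivWithin isOpen_Ioi.uniqueDiffOn).2
      ⟨fun t ht => (hd t ht).differentiableAt.differentiableWithinAt, ?_⟩
    refine ContinuousOn.congr (f := fun t => α * amplitude p K a ϑ t * pCos p (ϑ t)) ?_
      (fun t ht => by rw [derivWithin_of_isOpen isOpen_Ioi ht, (hd t ht).deriv])
    intro t ht
    exact ((continuousAt_const.mul (hasDerivAt_amplitude hp hα ha h ht).continuousAt).mul
      ((continuous_pCos hp).continuousAt.comp
        (h.isAngle t (ha.trans_lt ht)).continuousAt)).continuousWithinAt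
  · intro t ht
    have ht0 : 0 < t := ha.trans_lt ht
    have hA := amplitude_pos p K a ϑ t
    have h1 := (((hasDerivAt_amplitude hp hα ha h ht).const_mul α).rpow_const (p := p - 1)
      (Or.inl (mul_pos hα hA).ne')).mul
      ((hasDerivAt_pFlux hp (ϑ t)).comp t (h.isAngle t ht0))
    refine (h1.congr_of_eventuallyEq ?_).congr_deriv ?_
    · filter_upwards [Ioi_mem_nhds ht] with s hs using spow_deriv_wave hp hα ha h hs
    · rw [spow_deriv_wave hp hα ha h ht, signedPow_eq_spow, wave, spow_const_mul hA,
        Real.rpow_sub_one (mul_pos hα hA).ne', Real.mul_rpow hα.le hA.le]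
      have hlam' : lam = (p - 1) * (α * α ^ (p - 1)) := by
        rw [← sub_one_mul_alpha_rpow hp hlam, ← hαdef, Real.rpow_sub_one hα.ne']
        field_simp
      have hn : n - 1 = K * (p - 1) := by rw [hKdef]; field_simp
      simp only [Function.comp_apply, damping, angleField, angleForce, decayRate]
      rw [hn, hlam']
      have e1 := pSin_add_pCos hp (ϑ t)
      have e2 := pSin_mul_spow hp (ϑ t)
      generalize |pCos p (ϑ t)| ^ p = c at *
      generalize spow (p - 1) (pSin p (ϑ t)) = y at *
      generalize pSin p (ϑ t) = x at *
      generalize pFlux p (ϑ t) = f at *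
      generalize amplitude p K a ϑ t ^ (p - 1) = B at *
      generalize α ^ (p - 1) = D at *
      rw [← e2] at e1
      have e3 : c = 1 - x * y := by linarith
      rw [e3]
      field_simp
      ring

/-! ### Uniqueness -/

/-- A one-sided bound for the flux near the initial time. -/
theorem flux_le_of_hasDerivWithinAt_zero {v φ g : ℝ → ℝ} {a d n r C : ℝ} (ha : 0 ≤ a) (hn : 1 ≤ n)
    (hr : 0 < r)
    (hv0 : HasDerivWithinAt v 0 (Ici a) a) (hv : ∀ t, a < t → HasDerivAt v (spow r (φ t)) t)
    (hφ : ∀ t, a < t → HasDerivAt φ (damping n t * φ t - g t) t)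
    (hg : ∀ t ∈ Ioo a d, |g t| ≤ C) {t : ℝ} (ht : t ∈ Ioo a d) : φ t ≤ C * (t - a) := by
  by_contra hcon
  set η := φ t - C * (t - a) with hη
  have hη0 : 0 < η := by linarith
  have ht0 : 0 < t := ha.trans_lt ht.1
  have hC : 0 ≤ C := (abs_nonneg _).trans (hg t ht)
  -- The integrating factor `s^{n-1}` removes the damping.
  have hM : ∀ s, a < s → HasDerivAt (fun s => s ^ (n - 1) * φ s) (-(s ^ (n - 1) * g s)) s := by
    intro s hs
    have hs0 : 0 < s := ha.trans_lt hs
    refine ((Real.hasDerivAt_rpow_const (p := n - 1) (Or.inl hs0.ne')).mul (hφ s hs)).congr_deriv ?_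
    rw [Real.rpow_sub_one hs0.ne', damping]
    field_simp
    ring
  -- An excess `η` over the bound at `t` persists backwards down to `a`, so `v' ≥ η^r` on `(a, t)`,
  -- against `v'(a) = 0`.
  have hlow : ∀ s ∈ Ioo a t, η ≤ φ s := by
    intro s hs
    have hs0 : 0 < s := ha.trans_lt hs.1
    have hbd := Convex.norm_image_sub_le_of_norm_hasDerivWithin_le (s := Icc s t)
      (C := t ^ (n - 1) * C)
      (fun x hx => (hM x (hs.1.trans_le hx.1)).hasDerivWithinAt)
      (fun x hx => by
        have hx0 : 0 < x := hs0.trans_le hx.1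
        rw [norm_neg, norm_mul, Real.norm_of_nonneg (by positivity), Real.norm_eq_abs]
        have h1 := hg x ⟨hs.1.trans_le hx.1, hx.2.trans_lt ht.2⟩
        have h2 : x ^ (n - 1) ≤ t ^ (n - 1) :=
          Real.rpow_le_rpow hx0.le hx.2 (by linarith)
        gcongr) (convex_Icc s t) ⟨le_rfl, hs.2.le⟩ ⟨hs.2.le, le_rfl⟩
    rw [Real.norm_eq_abs, Real.norm_of_nonneg (by linarith [hs.2] : 0 ≤ t - s)] at hbd
    have h1 := (le_abs_self _).trans hbd
    have htn : 0 < t ^ (n - 1) := by positivity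
    have hsn : 0 < s ^ (n - 1) := by positivity
    have hst : s ^ (n - 1) ≤ t ^ (n - 1) := Real.rpow_le_rpow hs0.le hs.2.le (by linarith)
    have h2 : t ^ (n - 1) * η ≤ s ^ (n - 1) * φ s := by
      have h3 : t ^ (n - 1) * C * (t - s) ≤ t ^ (n - 1) * (C * (t - a)) := by
        rw [mul_assoc]; gcongr; exact hs.1.le
      rw [hη]; linarith
    have hφs : 0 < φ s := by
      by_contra hneg
      have h4 : s ^ (n - 1) * φ s ≤ 0 := mul_nonpos_of_nonneg_of_nonpos hsn.le (not_lt.1 hneg)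
      have h5 : 0 < t ^ (n - 1) * η := by positivity
      linarith
    have h6 : s ^ (n - 1) * φ s ≤ t ^ (n - 1) * φ s := by gcongr
    exact le_of_mul_le_mul_left (h2.trans h6) htn
  have hμ : 0 < η ^ r := by positivity
  have hslope : ∀ᶠ s in 𝓝[>] a, slope v a s < η ^ r :=
    ((hasDerivWithinAt_iff_tendsto_slope' self_notMem_Ioi).1
      hv0.Ioi_of_Ici).eventually_lt_const hμ
  obtain ⟨s, hs1, hs2⟩ := (hslope.and (Ioo_mem_nhdsGT ht.1)).exists
  have hgrow : η ^ r * (s - a) ≤ v s - v a := by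
    refine Convex.mul_sub_le_image_sub_of_le_deriv (convex_Icc a s) (fun x hx => ?_)
      (fun x hx => ?_) (fun x hx => ?_) a ⟨le_rfl, hs2.1.le⟩ s ⟨hs2.1.le, le_rfl⟩ hs2.1.le
    · rcases hx.1.eq_or_lt with rfl | hax
      · exact hv0.continuousWithinAt.mono Icc_subset_Ici_self
      · exact (hv x hax).continuousAt.continuousWithinAt
    · rw [interior_Icc] at hx
      exact (hv x hx.1).differentiableAt.differentiableWithinAt
    · rw [interior_Icc] at hx
      have h1 := hlow x ⟨hx.1, hx.2.trans hs2.2⟩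
      rw [(hv x hx.1).deriv, spow_of_pos (hη0.trans_le h1)]
      exact Real.rpow_le_rpow hη0.le h1 hr.le
  rw [slope_def_field, div_lt_iff₀ (by linarith [hs2.1])] at hs1
  linarith

/-! ### Initial behaviour and energy of an arbitrary solution -/

/-- The energy `|v|^p + |v'/α|^p`. -/
def energy (p α : ℝ) (v : ℝ → ℝ) (t : ℝ) : ℝ := |v t| ^ p + |deriv v t / α| ^ p

section Solution

variable {p lam n a : ℝ} {v : ℝ → ℝ}

theorem IsSolution.hasDerivAt {T : ℝ → ℝ} (h : IsSolution p lam T a v) {t : ℝ} (ht : a < t) :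
    HasDerivAt v (deriv v t) t :=
  ((h.contDiffOn.differentiableOn one_ne_zero).differentiableAt (Ioi_mem_nhds ht)).hasDerivAt

theorem IsSolution.continuousOn_deriv {T : ℝ → ℝ} (h : IsSolution p lam T a v) :
    ContinuousOn (deriv v) (Ioi a) :=
  h.contDiffOn.continuousOn_deriv_of_isOpen isOpen_Ioi le_rfl

theorem IsSolution.tendsto {T : ℝ → ℝ} (h : IsSolution p lam T a v) :
    Tendsto v (𝓝[>] a) (𝓝 (-1)) := by
  have := h.init_deriv.continuousWithinAt.mono Ioi_subset_Ici_self
  rwa [ContinuousWithinAt, h.init] at this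

theorem spow_inv_signedPow (hp : 1 < p) (x : ℝ) : spow (1 / (p - 1)) (signedPow p x) = x := by
  have : p - 1 ≠ 0 := by linarith
  rw [signedPow_eq_spow, spow_spow _ this, mul_one_div_cancel this, spow_one]

/-- `IsSolution` gives the derivative at `a` but not its continuity there. The one-sided flux bound,
applied to `v` and `-v`, supplies it. -/
theorem IsSolution.tendsto_deriv (hp : 1 < p) (hlam : 0 < lam) (hn : 1 ≤ n) (ha : 0 ≤ a)
    (h : IsSolution p lam (damping n) a v) : Tendsto (deriv v) (𝓝[>] a) (𝓝 0) := by
  have hp1 : 0 < p - 1 := by linarith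
  have hev : ∀ᶠ t in 𝓝[>] a, |v t| < 2 := by
    refine h.tendsto.abs.eventually_lt_const ?_
    simp
  obtain ⟨d, hd, hball⟩ := mem_nhdsGT_iff_exists_Ioo_subset.1 hev
  have hd : a < d := hd
  set C := lam * 2 ^ (p - 1) with hC
  have hg : ∀ t ∈ Ioo a d, |lam * signedPow p (v t)| ≤ C := by
    intro t ht
    have h1 : |v t| < 2 := hball ht
    rw [abs_mul, abs_of_pos hlam, signedPow_eq_spow, abs_spow hp1.ne', hC]
    gcongr
  have hr : 0 < 1 / (p - 1) := by positivity
  have hup : ∀ t ∈ Ioo a d, signedPow p (deriv v t) ≤ C * (t - a) := fun t ht =>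
    flux_le_of_hasDerivWithinAt_zero (φ := fun s => signedPow p (deriv v s)) ha hn hr h.init_deriv
      (fun s hs => by rw [spow_inv_signedPow hp]; exact h.hasDerivAt hs) h.ode hg ht
  have hlo : ∀ t ∈ Ioo a d, -signedPow p (deriv v t) ≤ C * (t - a) := by
    intro t ht
    refine flux_le_of_hasDerivWithinAt_zero (v := fun s => -v s)
      (φ := fun s => -signedPow p (deriv v s)) (g := fun s => -(lam * signedPow p (v s)))
      ha hn hr ?_ (fun s hs => ?_) (fun s hs => ?_) (fun s hs => ?_) ht
    · simpa using h.init_deriv.fun_neg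
    · rw [spow_neg, spow_inv_signedPow hp]; exact (h.hasDerivAt hs).fun_neg
    · exact (h.ode s hs).fun_neg.congr_deriv (by ring)
    · rw [abs_neg]; exact hg s hs
  have hflux : Tendsto (fun t => signedPow p (deriv v t)) (𝓝[>] a) (𝓝 0) := by
    have hlim : Tendsto (fun t : ℝ => C * (t - a)) (𝓝[>] a) (𝓝 0) := by
      have hc : Continuous fun t : ℝ => C * (t - a) := by fun_prop
      have := hc.tendsto a
      simp only [sub_self, mul_zero] at this
      exact this.mono_left nhdsWithin_le_nhds
    refine squeeze_zero_norm' ?_ hlim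
    filter_upwards [Ioo_mem_nhdsGT hd] with t ht
    rw [Real.norm_eq_abs, abs_le]
    exact ⟨by linarith [hlo t ht], hup t ht⟩
  have := ((continuous_spow hr).tendsto 0).comp hflux
  rw [spow_zero] at this
  exact this.congr fun t => spow_inv_signedPow hp _

/-- Only the flux of `v'` is known to be differentiable, so `|v'|^p` is written as its `p/(p-1)`
power. The relation `(p-1) α^p = λ` cancels the terms in `v`. -/
theorem IsSolution.hasDerivAt_energy (hp : 1 < p) (hlam : 0 < lam)
    (h : IsSolution p lam (damping n) a v) {t : ℝ} (ht : a < t) :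
    HasDerivAt (energy p (alpha p lam) v)
      (-(p * ((n - 1) / (p - 1)) / t) * |deriv v t / alpha p lam| ^ p) t := by
  set α := alpha p lam with hαdef
  have hα : 0 < α := alpha_pos hp hlam
  have hp0 : 0 < p := by linarith
  have hp1 : 0 < p - 1 := by linarith
  have hq : 1 < p / (p - 1) := by rw [lt_div_iff₀ hp1]; linarith
  have habs : ∀ s, |deriv v s / α| ^ p = |signedPow p (deriv v s)| ^ (p / (p - 1)) / α ^ p := by
    intro s
    rw [abs_div, abs_of_pos hα, Real.div_rpow (abs_nonneg _) hα.le, signedPow_eq_spow,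
      abs_spow hp1.ne', ← Real.rpow_mul (abs_nonneg _), mul_div_cancel₀ _ hp1.ne']
  have h1 := (hasDerivAt_abs_rpow_spow hp (v t)).comp t (h.hasDerivAt ht)
  have h2 := ((hasDerivAt_abs_rpow_spow hq (signedPow p (deriv v t))).comp t (h.ode t ht)).div_const
    (α ^ p)
  have hE : energy p α v = fun s =>
      |v s| ^ p + |signedPow p (deriv v s)| ^ (p / (p - 1)) / α ^ p := by
    funext s; rw [energy, habs]
  rw [hE]
  refine (h1.add h2).congr_deriv ?_
  have e1 : spow (p / (p - 1) - 1) (signedPow p (deriv v t)) = deriv v t := by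
    rw [show p / (p - 1) - 1 = 1 / (p - 1) by field_simp; ring]
    exact spow_inv_signedPow hp _
  have e2 : |deriv v t / α| ^ p = deriv v t * signedPow p (deriv v t) / α ^ p := by
    rw [abs_div, abs_of_pos hα, Real.div_rpow (abs_nonneg _) hα.le, signedPow_eq_spow,
      mul_spow _ (by linarith), sub_add_cancel]
  have e3 := sub_one_mul_alpha_rpow hp hlam
  rw [← hαdef] at e3
  have hαp : 0 < α ^ p := by positivity
  rw [e1, e2, damping, ← e3, signedPow_eq_spow p (v t)]
  field_simp
  ring

theorem IsSolution.tendsto_energy (hp : 1 < p) (hlam : 0 < lam) (hn : 1 ≤ n) (ha : 0 ≤ a)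
    (h : IsSolution p lam (damping n) a v) :
    Tendsto (energy p (alpha p lam) v) (𝓝[>] a) (𝓝 1) := by
  have h1 := h.tendsto.abs.rpow_const (p := p) (Or.inr (by linarith))
  have h2 := ((h.tendsto_deriv hp hlam hn ha).div_const (alpha p lam)).abs.rpow_const (p := p)
    (Or.inr (by linarith))
  have := h1.add h2
  simp only [abs_neg, abs_one, Real.one_rpow, zero_div, abs_zero,
    Real.zero_rpow (by linarith : p ≠ 0), add_zero] at this
  exact this

/-- The energy `E` satisfies `E' ≥ -(κ/t) E`, so `t^κ E` is nondecreasing, and `E` tends to `1` at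
`a`. This keeps the phase curve off the origin. -/
theorem IsSolution.energy_pos (hp : 1 < p) (hlam : 0 < lam) (hn : 1 ≤ n) (ha : 0 ≤ a)
    (h : IsSolution p lam (damping n) a v) {t : ℝ} (ht : a < t) :
    0 < energy p (alpha p lam) v t := by
  have hK : 0 ≤ p * ((n - 1) / (p - 1)) :=
    mul_nonneg (by linarith) (div_nonneg (by linarith) (by linarith))
  set κ := p * ((n - 1) / (p - 1)) with hκ
  have hd : ∀ s, a < s → HasDerivAt (fun s => s ^ κ * energy p (alpha p lam) v s)
      (κ * s ^ (κ - 1) * |v s| ^ p) s := by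
    intro s hs
    have hs0 : 0 < s := ha.trans_lt hs
    refine ((Real.hasDerivAt_rpow_const (p := κ) (Or.inl hs0.ne')).mul
      (h.hasDerivAt_energy hp hlam hs)).congr_deriv ?_
    rw [energy, Real.rpow_sub_one hs0.ne', ← hκ]
    field_simp
    ring
  have hmono : MonotoneOn (fun s => s ^ κ * energy p (alpha p lam) v s) (Ioi a) := by
    refine monotoneOn_of_deriv_nonneg (convex_Ioi a)
      (fun s hs => (hd s hs).continuousAt.continuousWithinAt) (fun s hs => ?_) (fun s hs => ?_)
    · rw [interior_Ioi] at hs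
      exact (hd s hs).differentiableAt.differentiableWithinAt
    · rw [interior_Ioi] at hs
      have hs0 : 0 < s := ha.trans_lt hs
      rw [(hd s hs).deriv]; positivity
  obtain ⟨s, hs1, hs2⟩ := (((h.tendsto_energy hp hlam hn ha).eventually_const_lt one_pos).and
    (Ioo_mem_nhdsGT ht)).exists
  have h1 := hmono (show s ∈ Ioi a from hs2.1) (show t ∈ Ioi a from ht) hs2.2.le
  have hs0 : 0 < s := ha.trans_lt hs2.1
  have ht0 : 0 < t := ha.trans_lt ht
  have h2 : 0 < s ^ κ * energy p (alpha p lam) v s := by positivity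
  exact pos_of_mul_pos_right (h2.trans_le h1) (by positivity)

end Solution

/-- A continuous nonvanishing planar curve has a continuous argument. -/
theorem exists_continuous_polar {X Y : ℝ → ℝ} {a β₀ : ℝ} (hX : Continuous X) (hY : Continuous Y)
    (hpos : ∀ t, 0 < X t ^ 2 + Y t ^ 2) (hX₀ : X a = √(X a ^ 2 + Y a ^ 2) * sin β₀)
    (hY₀ : Y a = √(X a ^ 2 + Y a ^ 2) * cos β₀) :
    ∃ β : ℝ → ℝ, Continuous β ∧ β a = β₀ ∧ (∀ t, X t = √(X t ^ 2 + Y t ^ 2) * sin (β t)) ∧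
      ∀ t, Y t = √(X t ^ 2 + Y t ^ 2) * cos (β t) := by
  set R : ℝ → ℝ := fun t => √(X t ^ 2 + Y t ^ 2) with hR
  have hRpos : ∀ t, 0 < R t := fun t => Real.sqrt_pos.2 (hpos t)
  have hRc : Continuous R := ((hX.pow 2).add (hY.pow 2)).sqrt
  set z : ℝ → ℂ := fun t => ⟨Y t / R t, X t / R t⟩ with hz
  have hznorm : ∀ t, z t ∈ Submonoid.unitSphere ℂ := by
    intro t
    refine mem_sphere_zero_iff_norm.2 ?_
    rw [← sq_eq_sq₀ (norm_nonneg _) zero_le_one, Complex.sq_norm,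
      Complex.normSq_apply]
    have h1 : R t ^ 2 = X t ^ 2 + Y t ^ 2 := Real.sq_sqrt (hpos t).le
    have := (hRpos t).ne'
    simp only [hz]
    field_simp
    linarith
  have hzc : Continuous z := by
    have h1 : Continuous fun t => Y t / R t := hY.div hRc fun t => (hRpos t).ne'
    have h2 : Continuous fun t => X t / R t := hX.div hRc fun t => (hRpos t).ne'
    have : z = fun t => ((Y t / R t : ℝ) : ℂ) + ((X t / R t : ℝ) : ℂ) * Complex.I := by
      funext t; simp [hz, Complex.ext_iff]
    rw [this]
    exact (Complex.continuous_ofReal.comp h1).add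
      ((Complex.continuous_ofReal.comp h2).mul continuous_const)
  let f : C(ℝ, Circle) := ⟨fun t => ⟨z t, hznorm t⟩, hzc.subtype_mk _⟩
  have hpolar : ∀ (t b : ℝ), Circle.exp b = f t ↔ (X t = R t * sin b ∧ Y t = R t * cos b) := by
    intro t b
    have hne := (hRpos t).ne'
    rw [← Circle.coe_inj, Circle.coe_exp]
    change Complex.exp (b * Complex.I) = z t ↔ _
    rw [Complex.ext_iff, Complex.exp_ofReal_mul_I_re, Complex.exp_ofReal_mul_I_im]
    simp only [hz]
    rw [eq_div_iff hne, eq_div_iff hne]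
    constructor
    · rintro ⟨h1, h2⟩; exact ⟨by linarith, by linarith⟩
    · rintro ⟨h1, h2⟩; exact ⟨by linarith, by linarith⟩
  obtain ⟨F, ⟨hF0, hF⟩, -⟩ := Circle.isCoveringMap_exp.existsUnique_continuousMap_lifts f a β₀
    ((hpolar a β₀).2 ⟨hX₀, hY₀⟩)
  exact ⟨F, F.continuous, hF0, fun t => ((hpolar t _).1 (congrFun hF t)).1,
    fun t => ((hpolar t _).1 (congrFun hF t)).2⟩

theorem continuous_ite_le {g : ℝ → ℝ} {a c : ℝ} (h1 : ContinuousOn g (Ioi a))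
    (h2 : Tendsto g (𝓝[>] a) (𝓝 c)) : Continuous fun t => if t ≤ a then c else g t := by
  rw [continuous_iff_continuousAt]
  intro t
  rcases lt_trichotomy t a with ht | rfl | ht
  · refine continuousAt_const.congr (f := fun _ => c) ?_
    filter_upwards [Iio_mem_nhds ht] with s hs
    rw [if_pos (le_of_lt hs)]
  · rw [continuousAt_iff_continuous_left_right]
    constructor
    · exact continuousWithinAt_const.congr (f := fun _ => c) (fun s hs => if_pos hs)
        (if_pos le_rfl)
    · rw [← continuousWithinAt_Ioi_iff_Ici, ContinuousWithinAt, if_pos le_rfl]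
      refine h2.congr' ?_
      filter_upwards [self_mem_nhdsWithin] with s hs
      rw [if_neg (not_le.2 hs)]
  · refine (h1.continuousAt (Ioi_mem_nhds ht)).congr ?_
    filter_upwards [Ioi_mem_nhds ht] with s hs
    rw [if_neg (not_le.2 hs)]

/-- Polar representation of a solution. -/
theorem IsSolution.exists_polar {p lam n a : ℝ} {v : ℝ → ℝ} (hp : 1 < p) (hlam : 0 < lam)
    (hn : 1 ≤ n) (ha : 0 ≤ a) (h : IsSolution p lam (damping n) a v) :
    ∃ ϑ : ℝ → ℝ, Continuous ϑ ∧ ϑ a = -quarter p ∧ ∀ t, a < t →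
      v t = energy p (alpha p lam) v t ^ (1 / p) * pSin p (ϑ t) ∧
      deriv v t = alpha p lam * energy p (alpha p lam) v t ^ (1 / p) * pCos p (ϑ t) := by
  set α := alpha p lam with hαdef
  have hα : 0 < α := alpha_pos hp hlam
  have hp0 : 0 < p := by linarith
  have hpow : 0 < p / 2 := by positivity
  have hvc : Continuous fun t => if t ≤ a then -1 else v t :=
    continuous_ite_le (fun t ht => (h.hasDerivAt ht).continuousAt.continuousWithinAt) h.tendsto
  have hdc : Continuous fun t => if t ≤ a then 0 else deriv v t :=
    continuous_ite_le h.continuousOn_deriv (h.tendsto_deriv hp hlam hn ha)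
  -- The power `p/2` turns the energy into `X² + Y²`, so ordinary polar coordinates apply; the curve
  -- is frozen at its initial point for `t ≤ a`.
  set X : ℝ → ℝ := fun t => spow (p / 2) (if t ≤ a then -1 else v t) with hX
  set Y : ℝ → ℝ := fun t => spow (p / 2) ((if t ≤ a then 0 else deriv v t) / α) with hY
  have hXc : Continuous X := (continuous_spow hpow).comp hvc
  have hYc : Continuous Y := (continuous_spow hpow).comp (hdc.div_const α)
  have hsq : ∀ x : ℝ, spow (p / 2) x ^ 2 = |x| ^ p := by
    intro x
    rw [← sq_abs, abs_spow hpow.ne', ← Real.rpow_natCast, ← Real.rpow_mul (abs_nonneg _)]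
    congr 1; push_cast; ring
  have hXm : ∀ t, t ≤ a → X t = -1 := fun t ht => by
    simp only [hX, if_pos ht, spow_neg, spow_of_pos one_pos, Real.one_rpow]
  have hYm : ∀ t, t ≤ a → Y t = 0 := fun t ht => by
    simp only [hY, if_pos ht, zero_div, spow_zero]
  have hXY : ∀ t, a < t → X t ^ 2 + Y t ^ 2 = energy p α v t := fun t ht => by
    simp only [hX, hY, if_neg (not_le.2 ht), hsq, energy]
  have hpos : ∀ t, 0 < X t ^ 2 + Y t ^ 2 := by
    intro t
    rcases le_or_gt t a with ht | ht
    · rw [hXm t ht, hYm t ht]; norm_num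
    · rw [hXY t ht]; exact h.energy_pos hp hlam hn ha ht
  obtain ⟨β, hβc, hβa, hβX, hβY⟩ := exists_continuous_polar (a := a) (β₀ := -(π / 2)) hXc hYc hpos
    (by simp [hXm a le_rfl, hYm a le_rfl]) (by simp [hXm a le_rfl, hYm a le_rfl])
  refine ⟨fun t => angleOf p (β t), (continuous_angleOf hp).comp hβc, ?_, fun t ht => ?_⟩
  · simp only [hβa, angleOf_neg, quarter]
  · have hE := h.energy_pos hp hlam hn ha ht
    have hinv : ∀ x : ℝ, spow (2 / p) (spow (p / 2) x) = x := fun x => by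
      rw [spow_spow _ hpow.ne', show p / 2 * (2 / p) = 1 by field_simp, spow_one]
    have hsqrt : √(energy p α v t) ^ (2 / p) = energy p α v t ^ (1 / p) := by
      rw [Real.sqrt_eq_rpow, ← Real.rpow_mul hE.le]
      congr 1; field_simp
    have h1 := congrArg (spow (2 / p)) (hβX t)
    have h2 := congrArg (spow (2 / p)) (hβY t)
    rw [hXY t ht, spow_const_mul (Real.sqrt_pos.2 hE), hsqrt] at h1 h2
    simp only [hX, hY, if_neg (not_le.2 ht), hinv] at h1 h2
    simp only [pSin, pCos, betaOf_angleOf hp]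
    refine ⟨h1, ?_⟩
    rw [div_eq_iff hα.ne'] at h2
    rw [h2]; ring

theorem pSin_ne_zero_of_pCos {p θ : ℝ} (hp : 1 < p) (h : pCos p θ = 0) : pSin p θ ≠ 0 := by
  intro h0
  have := pSin_add_pCos hp θ
  rw [h, h0, abs_zero, Real.zero_rpow (by linarith)] at this
  norm_num at this

/-- The angle of a solution solves the angle equation. -/
theorem IsSolution.isAngle_of_polar {p lam n a : ℝ} {v ϑ R : ℝ → ℝ} (hp : 1 < p) (hlam : 0 < lam)
    (ha : 0 ≤ a) (h : IsSolution p lam (damping n) a v) (hϑ : Continuous ϑ)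
    (hR : ∀ t, a < t → 0 < R t)
    (hR' : ∀ t, a < t → HasDerivAt R (-((n - 1) / (p - 1)) * decayRate p ϑ t * R t) t)
    (hv : ∀ t, a < t → v t = R t * pSin p (ϑ t))
    (hv' : ∀ t, a < t → deriv v t = alpha p lam * R t * pCos p (ϑ t)) :
    IsAngle p (alpha p lam) ((n - 1) / (p - 1)) a ϑ := by
  set α := alpha p lam with hαdef
  set K := (n - 1) / (p - 1) with hKdef
  have hα : 0 < α := alpha_pos hp hlam
  have hp1 : 0 < p - 1 := by linarith
  intro t ht
  have ht0 : 0 < t := ha.trans_lt ht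
  have hRt := hR t ht
  -- Where `C ≠ 0` the angle is recovered from `S(ϑ)`; where `C = 0` the sine is stationary, but the
  -- flux has nonzero slope.
  by_cases hC : pCos p (ϑ t) = 0
  · have hS := pSin_ne_zero_of_pCos hp hC
    have hF := pFlux_eq_zero_of_pCos hp hC
    have hf' : -(p - 1) * spow (p - 1) (pSin p (ϑ t)) ≠ 0 :=
      mul_ne_zero (by linarith) fun h0 => hS (spow_eq_zero.1 h0)
    have hflux : ∀ s, a < s →
        signedPow p (deriv v s) / (α * R s) ^ (p - 1) = pFlux p (ϑ s) := by
      intro s hs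
      have hRs := mul_pos hα (hR s hs)
      rw [hv' s hs, signedPow_eq_spow, spow_const_mul hRs, spow_pCos hp]
      field_simp
    have hdiv := (h.ode t ht).div (((hR' t ht).const_mul α).rpow_const (p := p - 1)
      (Or.inl (mul_pos hα hRt).ne')) (Real.rpow_pos_of_pos (mul_pos hα hRt) _).ne'
    have hcomp : HasDerivAt (fun s => pFlux p (ϑ s))
        (α * (-(p - 1) * spow (p - 1) (pSin p (ϑ t)))) t := by
      refine (hdiv.congr_of_eventuallyEq ?_).congr_deriv ?_
      · filter_upwards [Ioi_mem_nhds ht] with s hs using (hflux s hs).symm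
      · have h0 : signedPow p (deriv v t) = 0 := by
          rw [hv' t ht, hC, mul_zero, signedPow_eq_spow, spow_zero]
        have hlam' : lam = (p - 1) * (α * α ^ (p - 1)) := by
          rw [← sub_one_mul_alpha_rpow hp hlam, ← hαdef, Real.rpow_sub_one hα.ne']
          field_simp
        have hαp : 0 < α ^ (p - 1) := by positivity
        have hRp : 0 < R t ^ (p - 1) := by positivity
        rw [h0, hv t ht, signedPow_eq_spow, spow_const_mul hRt, Real.mul_rpow hα.le hRt.le,
          hlam']
        field_simp
        ring
    have := hasDerivAt_of_comp hϑ.continuousAt (hasDerivAt_pFlux hp (ϑ t)) hf' hcomp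
    rw [mul_div_cancel_right₀ _ hf'] at this
    refine this.congr_deriv ?_
    rw [angleField, angleForce, hF]; ring
  · have hdiv := (h.hasDerivAt ht).div (hR' t ht) hRt.ne'
    have hcomp : HasDerivAt (fun s => pSin p (ϑ s))
        (angleField p α K t (ϑ t) * pCos p (ϑ t)) t := by
      refine (hdiv.congr_of_eventuallyEq ?_).congr_deriv ?_
      · filter_upwards [Ioi_mem_nhds ht] with s hs
        have := (hR s hs).ne'
        simp only [Pi.div_apply]
        rw [hv s hs]; field_simp
      · rw [hv' t ht, hv t ht, decayRate, angleField, angleForce, ← pCos_mul_pFlux hp]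
        field_simp
        ring
    have := hasDerivAt_of_comp hϑ.continuousAt (hasDerivAt_pSin hp (ϑ t)) hC hcomp
    rwa [mul_div_cancel_right₀ _ hC] at this

/-- The angle of `v` is `ϑ` by uniqueness for the angle equation. Then `E^{1/p}` and the amplitude
solve the same linear equation and both tend to `1` at `a`. -/
theorem IsSolution.eqOn_wave {p lam n a : ℝ} {v ϑ : ℝ → ℝ} (hp : 1 < p) (hlam : 0 < lam)
    (hn : 1 ≤ n) (ha : 0 ≤ a) (hϑ : IsStart p (alpha p lam) ((n - 1) / (p - 1)) a ϑ)
    (h : IsSolution p lam (damping n) a v) :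
    EqOn v (wave p ((n - 1) / (p - 1)) a ϑ) (Ici a) := by
  obtain ⟨ψ, hψc, hψa, hψ⟩ := h.exists_polar hp hlam hn ha
  have hα : 0 < alpha p lam := alpha_pos hp hlam
  have hp0 : 0 < p := by linarith
  set R : ℝ → ℝ := fun t => energy p (alpha p lam) v t ^ (1 / p) with hRdef
  set K := (n - 1) / (p - 1) with hKdef
  have hK : 0 ≤ K := div_nonneg (by linarith) (by linarith)
  have hR : ∀ t, a < t → 0 < R t := fun t ht =>
    Real.rpow_pos_of_pos (h.energy_pos hp hlam hn ha ht) _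
  have hR' : ∀ t, a < t → HasDerivAt R (-K * decayRate p ψ t * R t) t := by
    intro t ht
    have hE := h.energy_pos hp hlam hn ha ht
    have ht0 : 0 < t := ha.trans_lt ht
    refine ((h.hasDerivAt_energy hp hlam ht).rpow_const (p := 1 / p)
      (Or.inl hE.ne')).congr_deriv ?_
    have h1 : |deriv v t / alpha p lam| ^ p
        = energy p (alpha p lam) v t * |pCos p (ψ t)| ^ p := by
      rw [(hψ t ht).2, show alpha p lam * energy p (alpha p lam) v t ^ (1 / p) * pCos p (ψ t)
        / alpha p lam = energy p (alpha p lam) v t ^ (1 / p) * pCos p (ψ t) by field_simp,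
        abs_mul, abs_of_pos (hR t ht), Real.mul_rpow (hR t ht).le (abs_nonneg _),
        ← Real.rpow_mul hE.le, one_div_mul_cancel hp0.ne', Real.rpow_one]
    rw [h1, Real.rpow_sub_one hE.ne', decayRate]
    simp only [hRdef, hKdef]
    field_simp
  have hang := h.isAngle_of_polar hp hlam ha hψc hR hR' (fun t ht => (hψ t ht).1)
    (fun t ht => (hψ t ht).2)
  have hlim : Tendsto ψ (𝓝[>] a) (𝓝 (-quarter p)) := by
    rw [← hψa]; exact (hψc.tendsto a).mono_left nhdsWithin_le_nhds
  have heq := hang.unique hp hK ha (hϑ.isAngle.mono ha) hlim (hϑ.tendsto hp hα)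
  have hamp : ∀ t, a < t → R t = amplitude p K a ϑ t := by
    intro t ht
    have hquot := eq_of_hasDerivAt_zero_of_tendsto (f := fun s => R s / amplitude p K a ϑ s)
      (a := a) (l := 1) (fun s hs => ?_) ?_ ht
    · rwa [div_eq_one_iff_eq (amplitude_pos _ _ _ _ _).ne'] at hquot
    · refine ((hR' s hs).div (hasDerivAt_amplitude hp hα ha hϑ hs)
        (amplitude_pos _ _ _ _ _).ne').congr_deriv ?_
      rw [decayRate, decayRate, heq hs]
      ring
    · have h1 := (h.tendsto_energy hp hlam hn ha).rpow_const (p := 1 / p)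
        (Or.inl one_ne_zero)
      have := h1.div (tendsto_amplitude hp hα ha hϑ) one_ne_zero
      rw [Real.one_rpow, div_one] at this
      exact this
  intro t ht
  rcases (show a ≤ t from ht).eq_or_lt with rfl | ht
  · rw [h.init, (isSolution_wave hp hlam ha hϑ).init]
  · rw [wave, ← hamp t ht, ← heq ht]; exact (hψ t ht).1

/-! ### The first critical point -/

theorem isSolution_sol {p lam n a : ℝ} {ϑ : ℝ → ℝ} (hp : 1 < p) (hlam : 0 < lam)
    (ha : 0 ≤ a) (hϑ : IsStart p (alpha p lam) ((n - 1) / (p - 1)) a ϑ) :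
    IsSolution p lam (damping n) a (sol p lam (damping n) a) := by
  have hex : ∃ w, IsSolution p lam (damping n) a w := ⟨_, isSolution_wave hp hlam ha hϑ⟩
  rw [sol, dif_pos hex]
  exact hex.choose_spec

theorem deriv_sol {p lam n a t : ℝ} {ϑ : ℝ → ℝ} (hp : 1 < p) (hlam : 0 < lam) (hn : 1 ≤ n)
    (ha : 0 ≤ a) (hϑ : IsStart p (alpha p lam) ((n - 1) / (p - 1)) a ϑ) (ht : a < t) :
    deriv (sol p lam (damping n) a) t
      = alpha p lam * amplitude p ((n - 1) / (p - 1)) a ϑ t * pCos p (ϑ t) := by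
  rw [← (hasDerivAt_wave hp (alpha_pos hp hlam) ha hϑ ht).deriv]
  refine Filter.EventuallyEq.deriv_eq ?_
  filter_upwards [Ioi_mem_nhds ht] with s hs
  exact (isSolution_sol hp hlam ha hϑ).eqOn_wave hp hlam hn ha hϑ (mem_Ici_of_Ioi hs)

theorem isLeast_critAfter {p lam n a b : ℝ} {ϑ : ℝ → ℝ} (hp : 1 < p) (hlam : 0 < lam)
    (hn : 1 ≤ n) (ha : 0 ≤ a) (hϑ : IsStart p (alpha p lam) ((n - 1) / (p - 1)) a ϑ)
    (hb : IsHit p a b ϑ) : IsLeast (critAfter p lam (damping n) a) b := by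
  have hα := alpha_pos hp hlam
  refine ⟨⟨hb.lt, ?_⟩, fun t ht => ?_⟩
  · rw [deriv_sol hp hlam hn ha hϑ hb.lt, hb.eq, pCos_quarter hp, mul_zero]
  · by_contra hcon
    have h1 := ht.2
    rw [deriv_sol hp hlam hn ha hϑ ht.1] at h1
    have h2 := pCos_pos hp ⟨hϑ.gt hp hα ha ht.1, hb.before t ht.1 (not_le.1 hcon)⟩
    exact (mul_pos (mul_pos hα (amplitude_pos _ _ _ _ _)) h2).ne' h1

theorem firstCrit_eq {p lam n a b : ℝ} {ϑ : ℝ → ℝ} (hp : 1 < p) (hlam : 0 < lam)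
    (hn : 1 ≤ n) (ha : 0 ≤ a) (hϑ : IsStart p (alpha p lam) ((n - 1) / (p - 1)) a ϑ)
    (hb : IsHit p a b ϑ) : firstCrit p lam (damping n) a = b :=
  (isLeast_critAfter hp hlam hn ha hϑ hb).csInf_eq

theorem firstMax_eq {p lam n a b : ℝ} {ϑ : ℝ → ℝ} (hp : 1 < p) (hlam : 0 < lam)
    (hn : 1 ≤ n) (ha : 0 ≤ a) (hϑ : IsStart p (alpha p lam) ((n - 1) / (p - 1)) a ϑ)
    (hb : IsHit p a b ϑ) :
    firstMax p lam (damping n) a = amplitude p ((n - 1) / (p - 1)) a ϑ b := by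
  rw [firstMax, firstCrit_eq hp hlam hn ha hϑ hb,
    (isSolution_sol hp hlam ha hϑ).eqOn_wave hp hlam hn ha hϑ (mem_Ici_of_Ioi hb.lt), wave, hb.eq,
    pSin_quarter hp, mul_one]

theorem wellDefined_damping {p lam n : ℝ} (hp : 1 < p) (hlam : 0 < lam) (hn : 1 ≤ n) :
    WellDefined p lam (damping n) := by
  intro a ha
  have hα := alpha_pos hp hlam
  have hK : 0 ≤ (n - 1) / (p - 1) := div_nonneg (by linarith) (by linarith)
  obtain ⟨ϑ, hϑ⟩ := exists_isStart (p := p) (K := (n - 1) / (p - 1)) hp hα hK ha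
  obtain ⟨b, hb⟩ := exists_isHit hp hα hK ha hϑ
  have hs := isSolution_sol hp hlam ha hϑ
  refine ⟨hs, fun v hv => ?_, ?_⟩
  · exact (hv.eqOn_wave hp hlam hn ha hϑ).trans (hs.eqOn_wave hp hlam hn ha hϑ).symm
  · rw [firstCrit_eq hp hlam hn ha hϑ hb]
    exact isLeast_critAfter hp hlam hn ha hϑ hb

theorem IsHit.amplitude_lt_one {p α K a b : ℝ} {ϑ : ℝ → ℝ} (hp : 1 < p) (hα : 0 < α) (hK : 0 < K)
    (ha : 0 ≤ a) (h : IsStart p α K a ϑ) (hb : IsHit p a b ϑ) : amplitude p K a ϑ b < 1 := by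
  have hpos : 0 < ∫ s in a..b, decayRate p ϑ s := by
    refine intervalIntegral.intervalIntegral_pos_of_pos_on
      (intervalIntegrable_decayRate hp hα ha h hb.lt.le) (fun t ht => ?_) hb.lt
    have h1 := pCos_pos hp ⟨h.gt hp hα ha ht.1, hb.before t ht.1 ht.2⟩
    have ht0 : 0 < t := ha.trans_lt ht.1
    have := abs_pos.2 h1.ne'
    unfold decayRate; positivity
  rw [amplitude, Real.exp_lt_one_iff]
  nlinarith

theorem exp_neg_le_amplitude {p α K a b : ℝ} {ϑ : ℝ → ℝ} (hp : 1 < p) (hα : 0 < α) (hK : 0 ≤ K)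
    (ha : 0 < a) (h : IsStart p α K a ϑ) (hab : a ≤ b) :
    exp (-K * ((b - a) / a)) ≤ amplitude p K a ϑ b := by
  have hle : ∫ s in a..b, decayRate p ϑ s ≤ ∫ _ in a..b, 1 / a := by
    refine intervalIntegral.integral_mono_on hab
      (intervalIntegrable_decayRate hp hα ha.le h hab) intervalIntegrable_const fun t ht => ?_
    have ht0 : 0 < t := ha.trans_le ht.1
    unfold decayRate
    have := abs_pCos_rpow_le_one hp (ϑ t)
    have := ht.1
    gcongr
  rw [intervalIntegral.integral_const, smul_eq_mul, mul_one_div] at hle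
  rw [amplitude, Real.exp_le_exp]
  nlinarith

/-! ### The extension to infinity and the theorem -/

theorem continuous_deltaExt {p lam : ℝ} {T : ℝ → ℝ} (h1 : ContinuousOn (delta p lam T) (Ici 0))
    (h2 : Tendsto (delta p lam T) atTop (𝓝 (piP p / alpha p lam))) :
    Continuous (deltaExt p lam T) := by
  rw [continuous_iff_continuousAt]
  intro x
  by_cases hx : x = ⊤
  · subst hx
    rw [ContinuousAt, deltaExt, if_pos rfl, Metric.tendsto_nhds]
    intro e he
    obtain ⟨A, hA⟩ := eventually_atTop.1 (Metric.tendsto_nhds.1 h2 e he)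
    filter_upwards [Ioi_mem_nhds (ENNReal.ofReal_lt_top : ENNReal.ofReal A < ⊤)] with y hy
    rw [deltaExt]
    split_ifs with hy'
    · simpa using he
    · exact hA _ (ENNReal.ofReal_le_iff_le_toReal hy' |>.1 (le_of_lt hy))
  · have hc : ContinuousAt (fun y : ℝ≥0∞ => delta p lam T y.toReal) x := by
      have h3 : Tendsto ENNReal.toReal (𝓝 x) (𝓝[Ici 0] x.toReal) :=
        tendsto_nhdsWithin_iff.2 ⟨ENNReal.tendsto_toReal hx,
          Eventually.of_forall fun y => ENNReal.toReal_nonneg⟩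
      exact (h1 x.toReal ENNReal.toReal_nonneg).tendsto.comp h3
    refine hc.congr ?_
    filter_upwards [isOpen_ne.mem_nhds hx] with y hy
    rw [deltaExt, if_neg hy]

end PModel

end

theorem mainTheorem6 (p lam n : ℝ) (hp : 1 < p) (hlam : 0 < lam) (hn : 1 < n) :
    -- the objects are well defined, both for `T = -(n-1)/t` and for `T = 0`
    PModel.WellDefined p lam (PModel.damping n) ∧
    PModel.WellDefined p lam (fun _ => 0) ∧
    -- `π_p / α` is the value of `δ` in the undamped case
    (∀ a, 0 ≤ a → PModel.delta p lam (fun _ => 0) a = PModel.piP p / PModel.alpha p lam) ∧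
    -- `δ` is continuous on `[0, ∞)`, above `π_p / α`, and tends to it
    ContinuousOn (PModel.delta p lam (PModel.damping n)) (Set.Ici 0) ∧
    (∀ a, 0 ≤ a →
      PModel.piP p / PModel.alpha p lam < PModel.delta p lam (PModel.damping n) a) ∧
    Filter.Tendsto (PModel.delta p lam (PModel.damping n)) Filter.atTop
      (nhds (PModel.piP p / PModel.alpha p lam)) ∧
    -- the first maximum
    (∀ a, 0 ≤ a → PModel.firstMax p lam (PModel.damping n) a < 1) ∧
    Filter.Tendsto (PModel.firstMax p lam (PModel.damping n)) Filter.atTop (nhds 1) ∧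
    -- the extension of `δ` to `[0, ∞]` is positive and continuous
    (∀ a, 0 < PModel.deltaExt p lam (PModel.damping n) a) ∧
    Continuous (PModel.deltaExt p lam (PModel.damping n)) := by
  open PModel Filter Topology Set in
  have hα := alpha_pos hp hlam
  have hp1 : 0 < p - 1 := by linarith
  have hK : 0 < (n - 1) / (p - 1) := div_pos (by linarith) hp1
  -- The undamped case is `n = 1`, that is `K = 0`; hence the lemmas above assume only `1 ≤ n` where
  -- they serve both cases.
  have hzero : (fun _ => 0 : ℝ → ℝ) = damping 1 := by funext t; simp [damping]
  have hlim_eq : piP p / alpha p lam = 2 * quarter p / alpha p lam := by rw [piP_eq hp]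
  have hpi : 0 < piP p / alpha p lam := by
    have := quarter_pos hp
    rw [hlim_eq]; positivity
  have hund : ∀ a, 0 ≤ a → delta p lam (fun _ => 0) a = piP p / alpha p lam := by
    intro a ha
    rw [hzero]
    obtain ⟨ϑ, hϑ⟩ := exists_isStart (p := p) (K := (1 - 1) / (p - 1)) hp hα (by simp) ha
    obtain ⟨b, hb⟩ := exists_isHit hp hα (by simp) ha hϑ
    rw [delta, firstCrit_eq hp hlam le_rfl ha hϑ hb, hlim_eq, eq_div_iff hα.ne']
    simp only [sub_self, zero_div] at hϑ
    linarith [hb.two_quarter_eq hp hα ha hϑ]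
  choose! Θ hΘ using fun a (ha : 0 ≤ a) =>
    exists_isStart (p := p) (K := (n - 1) / (p - 1)) hp hα hK.le ha
  choose! b hb using fun a (ha : 0 ≤ a) => exists_isHit hp hα hK.le ha (hΘ a ha)
  have hdelta : ∀ a, 0 ≤ a → delta p lam (damping n) a = b a - a := fun a ha => by
    rw [delta, firstCrit_eq hp hlam hn.le ha (hΘ a ha) (hb a ha)]
  have hcont : ContinuousOn (delta p lam (damping n)) (Ici 0) :=
    ((continuousOn_hit hp hα hK.le hΘ hb).sub continuousOn_id).congr fun a ha => hdelta a ha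
  have hgt : ∀ a, 0 ≤ a → piP p / alpha p lam < delta p lam (damping n) a := by
    intro a ha
    rw [hdelta a ha, hlim_eq, div_lt_iff₀ hα]
    linarith [(hb a ha).two_quarter_lt hp hα hK ha (hΘ a ha)]
  have hKa : Tendsto (fun a : ℝ => (n - 1) / (p - 1) / a) atTop (𝓝 0) :=
    tendsto_const_nhds.div_atTop tendsto_id
  have hup : Tendsto (fun a : ℝ => 2 * quarter p / (alpha p lam - (n - 1) / (p - 1) / a)) atTop
      (𝓝 (piP p / alpha p lam)) := by
    rw [hlim_eq]
    have := (hKa.const_sub (alpha p lam))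
    rw [sub_zero] at this
    exact tendsto_const_nhds.div this hα.ne'
  have htend : Tendsto (delta p lam (damping n)) atTop (𝓝 (piP p / alpha p lam)) := by
    refine tendsto_of_tendsto_of_tendsto_of_le_of_le' tendsto_const_nhds hup ?_ ?_
    · filter_upwards [eventually_ge_atTop 0] with a ha using (hgt a ha).le
    · filter_upwards [eventually_gt_atTop 0, hKa.eventually_lt_const hα] with a ha hα'
      rw [hdelta a ha.le, le_div_iff₀ (by linarith)]
      linarith [(hb a ha.le).sub_mul_le hp hK.le ha (hΘ a ha.le)]
  have hmax : ∀ a, 0 ≤ a → firstMax p lam (damping n) a < 1 := by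
    intro a ha
    rw [firstMax_eq hp hlam hn.le ha (hΘ a ha) (hb a ha)]
    exact (hb a ha).amplitude_lt_one hp hα hK ha (hΘ a ha)
  have hmaxlim : Tendsto (firstMax p lam (damping n)) atTop (𝓝 1) := by
    -- Since `|C|^p/t ≤ 1/a` on the passage, `m(a) ≥ exp(-K δ(a)/a)`, and `δ` has a finite limit.
    have hlow : Tendsto (fun a : ℝ => Real.exp (-((n - 1) / (p - 1)) *
        (delta p lam (damping n) a / a))) atTop (𝓝 1) := by
      have h1 := (htend.div_atTop tendsto_id).const_mul (-((n - 1) / (p - 1)))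
      have := (Real.continuous_exp.tendsto _).comp h1
      rw [mul_zero, Real.exp_zero] at this
      exact this
    refine tendsto_of_tendsto_of_tendsto_of_le_of_le' hlow tendsto_const_nhds ?_ ?_
    · filter_upwards [eventually_gt_atTop 0] with a ha
      rw [hdelta a ha.le, firstMax_eq hp hlam hn.le ha.le (hΘ a ha.le) (hb a ha.le)]
      exact exp_neg_le_amplitude hp hα hK.le ha (hΘ a ha.le) (hb a ha.le).lt.le
    · filter_upwards [eventually_ge_atTop 0] with a ha using (hmax a ha).le
  refine ⟨wellDefined_damping hp hlam hn.le, ?_, hund, hcont, hgt, htend, hmax, hmaxlim, ?_,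
    continuous_deltaExt hcont htend⟩
  · rw [hzero]; exact wellDefined_damping hp hlam le_rfl
  · intro x
    rw [deltaExt]
    split_ifs with hx
    · exact hpi
    · exact hpi.trans (hgt _ ENNReal.toReal_nonneg)
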